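/- Let $P\subset\mathbb R^N$ be a nonempty convex polytope of dimension $d$. The faces of $P$ are $\emptyset$ and the sets of maximizers over $P$ of linear functionals (so $P$ is a face). Let $\mathcal C_P$ be a pointed triangulation of $P$: a finite geometric simplicial complex with underlying set $P$, together with a vertex $\mathbf v_F$ of $F$ (the apex) for each nonempty face $F$ of $P$, such that, with $\mathcal C_F=\{\sigma\in\mathcal C_P:\sigma\subseteq F\}$, (1) $\mathbf v_F$ lies in every simplex of $\mathcal C_F$ of dimension $\dim F$; (2) if $F_1,F_2$ are nonempty faces with $\{\mathbf v_{F_1},\mathbf v_{F_2}\}\subseteq F_1\cap F_2$, then $\mathbf v_{F_1}=\mathbf v_{F_2}$; (3) for each vertex $\mathbf w\ne\mathbf v_F$ of $F$, the edge $\mathrm{Conv}\{\mathbf v_F,\mathbf w\}$ is in $\mathcal C_F$. Polytope numbers. The numbers $P(n)$ and interior numbers $P(n)^\#$ ($n\ge 0$) with respect to the apexes are defined recursively. If $\dim P=0$, then $P(0)=P(0)^\#=0$ and $P(n)=P(n)^\#=1$ for $n\ge1$. If $\dim P>0$, then $P(0)=P(0)^\#=P(1)^\#=0$, $P(1)=1$,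 and for $n\ge 2$ $$P(n)=P(n-1)+\sum_{F:\ \mathbf v_P\notin F}F(n)^\#,\qquad P(n)^\#=P(n)-\sum_{F\neq P}F(n)^\#,$$ the sums being over nonempty faces $F$ of $P$. Put $\alpha^d(m)=\binom{m+d-1}{d}$ for integers $m\ge1$ and $\alpha^d(m)=0$ for $m\le 0$. The $k$-vector. Let $\mathbf x\in P$ be in general position, i.e. in the affine hull of no simplex of $\mathcal C_P$ of dimension less than $d$. For a $d$-simplex $F\in\mathcal C_P$, a nonempty facet of $F$ is visible if, for each $\mathbf y$ in its relative interior, no point strictly between $\mathbf x$ and $\mathbf y$ is in $F$; the empty facet (if $d=0$) is not visible. Let $D_F$ be the set of the vertices of $F$ opposite to the facets of $F$ that are not visible, and $[D_F,F]$ the set of the faces of $F$ whose vertex set contains $D_F$. Let $k_j$ be the number of $d$-simplices $F\in\mathcal C_P$ with $|D_F|=j$, and let $\mathcal I_P$ be the set of the simplices of $\mathcal C_P$ contained in no face of $P$ other than $P$. Then: (i) $\mathcal I_P$ is the disjoint union of the intervals $[D_F,F]$ over all $d$-simplices $F$ of $\mathcal C_P$. (ii) For all integers $n\ge 0$, except $n=1$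 in the case $d=0$, $$P(n)^\#=\sum_{j=0}^{d+1}k_j\,\alpha^d(n-j).$$ (iii) The numbers $\alpha^d(m)$, $m\ge0$, in (ii) are the polytope numbers of every $d$-simplex in $\mathbb R^N$, for every choice of a vertex of each nonempty face as its apex. -/

import Mathlib

namespace PolytopeNumbers

/-- A (convex) polytope is the convex hull of a finite set of points. -/
def IsPolytope {V : Type*} [AddCommGroup V] [Module ℝ V] (P : Set V) : Prop :=
  ∃ s : Set V, s.Finite ∧ P = convexHull ℝ s

/-- The dimension of a nonempty set: the dimension of its affine hull. -/
noncomputable def dim {V : Type*} [AddCommGroup V] [Module ℝ V] (P : Set V) : ℕ :=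
  Module.finrank ℝ (vectorSpan ℝ P)

/-- `F` is a face of the polytope `P`: it is empty, or the set of all points of `P` at which some
linear functional attains its maximum over `P`. Both `∅` and `P` are faces of `P`. -/
def IsFace {V : Type*} [NormedAddCommGroup V] [NormedSpace ℝ V] (P F : Set V) : Prop :=
  IsExposed ℝ P F

/-- The nonempty faces of `P` other than `P` itself. -/
def properFaces {V : Type*} [NormedAddCommGroup V] [NormedSpace ℝ V] (P : Set V) :
    Set (Set V) :=
  {F | IsFace P F ∧ F.Nonempty ∧ F ≠ P}

/-- A nonempty proper face has smaller dimension; this makes the recursion below well-founded. -/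
theorem dim_lt_of_mem_properFaces {V : Type*} [NormedAddCommGroup V] [NormedSpace ℝ V]
    [FiniteDimensional ℝ V] {P F : Set V} (hF : F ∈ properFaces P) : dim F < dim P := by
  obtain ⟨hface, hne, hneq⟩ := hF
  obtain ⟨l, hl⟩ := hface hne
  have hsub : F ⊆ P := by rw [hl]; exact fun x hx => hx.1
  obtain ⟨a, ha⟩ := hne
  obtain ⟨b, hbP, hbF⟩ : ∃ b ∈ P, b ∉ F := by
    by_contra! h
    exact hneq (Set.Subset.antisymm hsub h)
  have ha' := ha
  rw [hl] at ha'
  have hker : vectorSpan ℝ F ≤ LinearMap.ker (l : V →ₗ[ℝ] ℝ) := by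
    rw [vectorSpan_def, Submodule.span_le]
    rintro _ ⟨y, hy, z, hz, rfl⟩
    rw [hl] at hy hz
    have h := le_antisymm (hz.2 y hy.1) (hy.2 z hz.1)
    simp [h]
  refine Submodule.finrank_lt_finrank_of_lt (lt_of_le_of_ne (vectorSpan_mono ℝ hsub) ?_)
  intro heq
  have hab : a -ᵥ b ∈ vectorSpan ℝ P := vsub_mem_vectorSpan ℝ (hsub ha) hbP
  rw [← heq] at hab
  have h0 : l a = l b := by
    have := hker hab
    simpa [sub_eq_zero] using this
  apply hbF
  rw [hl]
  exact ⟨hbP, fun y hy => h0 ▸ ha'.2 y hy⟩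

open Classical in
/-- The recursion on `n` for the polytope numbers `P(n)` of a polytope of positive dimension with
apex `v P`, where `I F n` are the interior numbers `F(n)^#` of the nonempty proper faces `F`:
`P(0) = 0`, `P(1) = 1`, and `P(n) = P(n-1) + ∑ F(n)^#` for `n ≥ 2`, the sum being over the faces
`F` that do not contain `v P`. -/
noncomputable def numberRec {V : Type*} [NormedAddCommGroup V] [NormedSpace ℝ V]
    (v : Set V → V) (P : Set V) (I : properFaces P → ℕ → ℤ) : ℕ → ℤ
  | 0 => 0
  | 1 => 1
  | n + 2 => numberRec v P I (n + 1) +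
      ∑ᶠ F : properFaces P, if v P ∉ (F : Set V) then I F (n + 2) else 0

/-- The interior polytope numbers `P(n)^#` with respect to the apexes `v F` of the faces `F`. -/
noncomputable def interiorNumber {V : Type*} [NormedAddCommGroup V] [NormedSpace ℝ V]
    [FiniteDimensional ℝ V] (v : Set V → V) (P : Set V) (n : ℕ) : ℤ :=
  if dim P = 0 then (if n = 0 then 0 else 1)
  else if n ≤ 1 then 0
  else numberRec v P (fun F m => interiorNumber v F.1 m) n -
    ∑ᶠ F : properFaces P, interiorNumber v F.1 n
termination_by dim P
decreasing_by all_goals exact dim_lt_of_mem_properFaces F.2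

/-- The polytope numbers `P(n)` with respect to the apexes `v F` of the faces `F`. -/
noncomputable def polytopeNumber {V : Type*} [NormedAddCommGroup V] [NormedSpace ℝ V]
    [FiniteDimensional ℝ V] (v : Set V → V) (P : Set V) (n : ℕ) : ℤ :=
  if dim P = 0 then (if n = 0 then 0 else 1)
  else numberRec v P (fun F m => interiorNumber v F.1 m) n

/-- The simplex numbers `α^d(m) = (m + d - 1).choose d` for `m ≥ 1`, and `0` for `m ≤ 0`. -/
def simplexNumber (d : ℕ) (m : ℤ) : ℤ :=
  if m ≤ 0 then 0 else ((m.toNat + d - 1).choose d : ℤ)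

/-- Every nonempty face `F` of `P` is assigned a vertex `v F` of `F`. -/
def IsApexChoice {V : Type*} [NormedAddCommGroup V] [NormedSpace ℝ V]
    (P : Set V) (v : Set V → V) : Prop :=
  ∀ F, IsFace P F → F.Nonempty → v F ∈ F.extremePoints ℝ

/-- The part of a simplicial complex that lies in `F`. If `K` triangulates a polytope and `F` is a
face of it, this is the induced triangulation of `F`. Simplices are given by their vertex sets,
and the empty simplex is left out. -/
def inducedFaces {V : Type*} [AddCommGroup V] [Module ℝ V]
    (K : Geometry.SimplicialComplex ℝ V) (F : Set V) : Set (Finset V) :=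
  {σ | σ ∈ K.faces ∧ convexHull ℝ (σ : Set V) ⊆ F}

/-- `K` is a pointed triangulation of the polytope `P` with apexes `v F`. -/
structure IsPointedTriangulation {V : Type*} [NormedAddCommGroup V] [NormedSpace ℝ V]
    (P : Set V) (v : Set V → V) (K : Geometry.SimplicialComplex ℝ V) : Prop where
  finite_faces : K.faces.Finite
  space_eq : K.space = P
  /-- The apex of a face `F` is a vertex of `F` ... -/
  apex_vertex : IsApexChoice P v
  /-- ... that lies in every simplex of dimension `dim F` of the triangulation of `F`. -/
  apex_mem : ∀ F, IsFace P F → F.Nonempty → ∀ σ ∈ inducedFaces K F, σ.card = dim F + 1 →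
    v F ∈ convexHull ℝ (σ : Set V)
  apex_unique : ∀ F₁ F₂, IsFace P F₁ → F₁.Nonempty → IsFace P F₂ → F₂.Nonempty →
    v F₁ ∈ F₁ ∩ F₂ → v F₂ ∈ F₁ ∩ F₂ → v F₁ = v F₂
  edge_mem : ∀ F, IsFace P F → F.Nonempty → ∀ w ∈ F.extremePoints ℝ, w ≠ v F →
    ∃ σ ∈ inducedFaces K F, (σ : Set V) = {v F, w}

/-- `𝓘_P`: the simplices of the triangulation `K` of `P` that lie in no face of `P` other than `P`.
(The empty simplex lies in the face `∅`, so nothing is lost by leaving it out.) -/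
def interiorSimplices {V : Type*} [NormedAddCommGroup V] [NormedSpace ℝ V]
    (P : Set V) (K : Geometry.SimplicialComplex ℝ V) : Set (Finset V) :=
  {σ | σ ∈ K.faces ∧ ∀ G, IsFace P G → G ≠ P → ¬ convexHull ℝ (σ : Set V) ⊆ G}

/-- The simplices of `K` of dimension `dim P`. -/
def topSimplices {V : Type*} [AddCommGroup V] [Module ℝ V]
    (P : Set V) (K : Geometry.SimplicialComplex ℝ V) : Set (Finset V) :=
  {σ | σ ∈ K.faces ∧ σ.card = dim P + 1}

/-- `x` is a point of `P` in general position with respect to `K`: it is in the affine hull of no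
simplex of `K` of dimension less than `dim P`. -/
def IsGeneric {V : Type*} [AddCommGroup V] [Module ℝ V]
    (P : Set V) (K : Geometry.SimplicialComplex ℝ V) (x : V) : Prop :=
  x ∈ P ∧ ∀ σ ∈ K.faces, σ.card < dim P + 1 → x ∉ affineSpan ℝ (σ : Set V)

/-- The facet `G` of the simplex with vertex set `σ` is visible from `x`: no point strictly between
`x` and a relative interior point of `G` is in the simplex. (The empty face, the only facet of
a point, is not visible.) -/
def FacetVisible {V : Type*} [NormedAddCommGroup V] [NormedSpace ℝ V]
    (x : V) (σ G : Finset V) : Prop :=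
  G.Nonempty ∧ ∀ y ∈ intrinsicInterior ℝ (convexHull ℝ (G : Set V)),
    IsVisible ℝ (convexHull ℝ (σ : Set V)) x y

open Classical in
/-- `D_F` for the simplex `F` with vertex set `σ`: the set of the vertices `w` of `F` whose opposite
facet, with vertex set `σ \ {w}`, is not visible from `x`. -/
noncomputable def oppNotVisible {V : Type*} [NormedAddCommGroup V] [NormedSpace ℝ V]
    (x : V) (σ : Finset V) : Finset V :=
  {w ∈ σ | ¬ FacetVisible x σ (σ.erase w)}

/-- `k_j`: the number of top-dimensional simplices `F` of the triangulation with `|D_F| = j`. -/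
noncomputable def kVector {V : Type*} [NormedAddCommGroup V] [NormedSpace ℝ V]
    (P : Set V) (K : Geometry.SimplicialComplex ℝ V) (x : V) (j : ℕ) : ℕ :=
  {σ | σ ∈ topSimplices P K ∧ (oppNotVisible x σ).card = j}.ncard

end PolytopeNumbers

/-! Part (i) comes from walking away from `x`. Let `p` be a relative interior point of a simplex `τ`
that lies in no proper face of `P`. The segment from `x` to `p` can be prolonged a little past `p`
inside `P`, and by genericity of `x` the points just past `p` lie in the interior of exactly one top
simplex `σ`, which contains `τ`. If `l` are the barycentric coordinates of `x` in `σ`, the displaced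
point has coordinate `t * l z` with `t < 0` at a vertex `z ∉ τ`. So `l z < 0`, which by
`facetVisible_erase_iff` means that the facet opposite `z` is visible. Hence `τ` is in `[D_σ, σ]`,
and the argument reverses (`eventually_coord_pos`).

For (ii), the recursion is solved by counting simplices: `P(n+2)^#` is the sum of `n.choose (dim τ)`
over the interior simplices `τ` (`IsConeTriangulation.interiorNumber_eq`). The apex of `P` is in
every top simplex, so the triangulation is a cone over it: simplices through the apex correspond to
simplices avoiding it, together with the empty one. Each simplex is interior to exactly one face,
its carrier, which contains the apex only if the simplex does (`IsConeTriangulation.apex_mem_iff`);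
the recursion thereby becomes Pascal's rule. By (i) the sum splits over the intervals `[D_σ, σ]`,
and Vandermonde's identity evaluates each to a simplex number (`sum_Icc_choose`).

For (iii), the complex of all faces of a simplex is a cone for every choice of apexes, so the solved
recursion and Vandermonde apply again. -/

open Filter Topology AffineMap

namespace PolytopeNumbers

/-! ### Barycentric coordinates -/

section Barycentric

variable {V : Type*} [AddCommGroup V] [Module ℝ V]

/-- `w` is a system of barycentric coordinates of `p` with respect to the points of `σ`. -/
def IsBary (σ : Finset V) (w : V → ℝ) (p : V) : Prop :=
  ∑ y ∈ σ, w y = 1 ∧ ∑ y ∈ σ, w y • y = p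

theorem IsBary.unique {σ : Finset V} (hσ : AffineIndependent ℝ ((↑) : σ → V)) {w w' : V → ℝ}
    {p : V} (h : IsBary σ w p) (h' : IsBary σ w' p) {y : V} (hy : y ∈ σ) : w y = w' y := by
  have := affineIndependent_iff.1 hσ Finset.univ (fun y => w y - w' y)
    (by
      rw [Finset.sum_coe_sort σ (fun y => w y - w' y), Finset.sum_sub_distrib, h.1, h'.1, sub_self])
    (by
      rw [Finset.sum_coe_sort σ (fun y => (w y - w' y) • y)]
      simp_rw [sub_smul]
      rw [Finset.sum_sub_distrib, h.2, h'.2, sub_self])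
    ⟨y, hy⟩ (Finset.mem_univ _)
  exact sub_eq_zero.1 this

theorem IsBary.lineMap {σ : Finset V} {w w' : V → ℝ} {p q : V} (h : IsBary σ w p)
    (h' : IsBary σ w' q) (t : ℝ) :
    IsBary σ (fun y => (1 - t) * w y + t * w' y) (AffineMap.lineMap p q t) := by
  constructor
  · rw [Finset.sum_add_distrib, ← Finset.mul_sum, ← Finset.mul_sum, h.1, h'.1]; ring
  · simp_rw [add_smul, mul_smul]
    rw [Finset.sum_add_distrib, ← Finset.smul_sum, ← Finset.smul_sum, h.2, h'.2,
      AffineMap.lineMap_apply_module]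

theorem IsBary.extend [DecidableEq V] {τ σ : Finset V} {w : V → ℝ} {p : V}
    (h : IsBary τ w p) (hτσ : τ ⊆ σ) : IsBary σ (fun y => if y ∈ τ then w y else 0) p := by
  constructor
  · rw [← h.1, Finset.sum_ite_mem, Finset.inter_eq_right.2 hτσ]
  · simp_rw [ite_smul, zero_smul]
    rw [← h.2, Finset.sum_ite_mem, Finset.inter_eq_right.2 hτσ]

theorem IsBary.restrict {τ σ : Finset V} {w : V → ℝ} {p : V} (h : IsBary σ w p) (hτσ : τ ⊆ σ)
    (h0 : ∀ y ∈ σ, y ∉ τ → w y = 0) : IsBary τ w p :=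
  ⟨by rw [← h.1]; exact Finset.sum_subset hτσ h0,
   by rw [← h.2]; exact Finset.sum_subset hτσ fun y hy hy' => by rw [h0 y hy hy', zero_smul]⟩

theorem isBary_vertex [DecidableEq V] {σ : Finset V} {z : V} (hz : z ∈ σ) :
    IsBary σ (fun y => if y = z then 1 else 0) z := by
  simp [IsBary, hz]

theorem mem_convexHull_iff_isBary {σ : Finset V} {p : V} :
    p ∈ convexHull ℝ (σ : Set V) ↔ ∃ w, IsBary σ w p ∧ ∀ y ∈ σ, 0 ≤ w y := by
  rw [Finset.mem_convexHull']
  exact ⟨fun ⟨w, h0, h1, h2⟩ => ⟨w, ⟨h1, h2⟩, h0⟩, fun ⟨w, ⟨h1, h2⟩, h0⟩ => ⟨w, h0, h1, h2⟩⟩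

theorem mem_affineSpan_iff_isBary {σ : Finset V} {p : V} :
    p ∈ affineSpan ℝ (σ : Set V) ↔ ∃ w, IsBary σ w p := by
  classical
  constructor
  · intro h
    have h' : p ∈ affineSpan ℝ (Set.range ((↑) : σ → V)) := by simpa using h
    obtain ⟨w, hw1, hw2⟩ := eq_affineCombination_of_mem_affineSpan_of_fintype h'
    refine ⟨fun y => if hy : y ∈ σ then w ⟨y, hy⟩ else 0, ?_, ?_⟩
    · rw [← hw1, ← Finset.sum_coe_sort σ]
      simp
    · rw [hw2, Finset.affineCombination_eq_linear_combination _ _ _ hw1, ← Finset.sum_coe_sort σ]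
      simp
  · rintro ⟨w, h1, h2⟩
    rw [← h2]
    have h3 := affineCombination_mem_affineSpan_image (k := ℝ) (s := σ) (w := w) h1
      (s' := (σ : Set V)) (fun y hy hy' => absurd hy hy') id
    rwa [Finset.affineCombination_eq_linear_combination _ _ _ h1, Set.image_id] at h3

theorem IsBary.mem_affineSpan {σ : Finset V} {w : V → ℝ} {p : V} (h : IsBary σ w p) :
    p ∈ affineSpan ℝ (σ : Set V) := mem_affineSpan_iff_isBary.2 ⟨w, h⟩

theorem IsBary.mem_convexHull {σ : Finset V} {w : V → ℝ} {p : V} (h : IsBary σ w p)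
    (h0 : ∀ y ∈ σ, 0 ≤ w y) : p ∈ convexHull ℝ (σ : Set V) :=
  mem_convexHull_iff_isBary.2 ⟨w, h, h0⟩

theorem exists_isBary_pos {σ : Finset V} (hσ : σ.Nonempty) :
    ∃ w p, IsBary σ w p ∧ ∀ y ∈ σ, 0 < w y := by
  have hc : (0 : ℝ) < σ.card := by exact_mod_cast hσ.card_pos
  refine ⟨fun _ => (σ.card : ℝ)⁻¹, _, ⟨?_, rfl⟩, fun _ _ => by positivity⟩
  simp [hc.ne']

theorem isBary_nonneg_of_mem_convexHull {σ : Finset V} (hσ : AffineIndependent ℝ ((↑) : σ → V))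
    {w : V → ℝ} {p : V} (h : IsBary σ w p) (hp : p ∈ convexHull ℝ (σ : Set V)) {y : V}
    (hy : y ∈ σ) : 0 ≤ w y := by
  obtain ⟨w', hw', h0⟩ := mem_convexHull_iff_isBary.1 hp
  rw [h.unique hσ hw' hy]
  exact h0 y hy

/-- An affine subspace containing two points of the line through `p` and `x` contains `x`. -/
theorem lineMap_mem_affineSpan_of_mem {s : AffineSubspace ℝ V} {p x : V} {t : ℝ} (ht : t ≠ 0)
    (hp : p ∈ s) (hq : AffineMap.lineMap p x t ∈ s) : x ∈ s := by
  have := AffineMap.lineMap_mem t⁻¹ hp hq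
  rwa [AffineMap.lineMap_lineMap_right, inv_mul_cancel₀ ht, AffineMap.lineMap_apply_one] at this

end Barycentric

/-! ### Exposed faces, relative interior and dimension -/

section Faces

variable {V : Type*} [NormedAddCommGroup V] [NormedSpace ℝ V]

theorem eventually_lineMap_mem_of_mem_intrinsicInterior {P : Set V} {p x : V}
    (hp : p ∈ intrinsicInterior ℝ P) (hx : x ∈ affineSpan ℝ P) :
    ∀ᶠ t in 𝓝 (0 : ℝ), AffineMap.lineMap p x t ∈ P := by
  obtain ⟨y, hy, rfl⟩ := mem_intrinsicInterior.1 hp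
  have hc : Continuous fun t : ℝ =>
      (⟨AffineMap.lineMap (y : V) x t, AffineMap.lineMap_mem t y.2 hx⟩ : affineSpan ℝ P) :=
    Continuous.subtype_mk AffineMap.lineMap_continuous _
  have h0 : (⟨AffineMap.lineMap (y : V) x (0 : ℝ), AffineMap.lineMap_mem 0 y.2 hx⟩ :
      affineSpan ℝ P) = y := Subtype.ext (AffineMap.lineMap_apply_zero _ _)
  have := hc.tendsto 0
  rw [h0] at this
  filter_upwards [this (isOpen_interior.mem_nhds hy)] with t ht
  exact interior_subset (s := ((↑) ⁻¹' P : Set (affineSpan ℝ P))) ht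

/-- Translating `P` into its direction space makes it full-dimensional, so that a convex `P`
acquires an honest interior there and open-set separation applies. -/
theorem vectorSpan_comap_subtype_eq_top {P : Set V} {p : V} (hp : p ∈ P) :
    affineSpan ℝ {w : vectorSpan ℝ P | p + (w : V) ∈ P} = ⊤ := by
  set Q : Set (vectorSpan ℝ P) := {w | p + (w : V) ∈ P}
  have h0 : (0 : vectorSpan ℝ P) ∈ Q := by simpa [Q] using hp
  rw [AffineSubspace.affineSpan_eq_top_iff_vectorSpan_eq_top_of_nonempty ℝ _ _ ⟨0, h0⟩]
  rw [vectorSpan_eq_span_vsub_set_right ℝ h0]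
  have himg : (vectorSpan ℝ P).subtype '' ((· -ᵥ (0 : vectorSpan ℝ P)) '' Q) = (· -ᵥ p) '' P := by
    ext u
    constructor
    · rintro ⟨_, ⟨w, hw, rfl⟩, rfl⟩
      exact ⟨p + w, hw, by simp⟩
    · rintro ⟨z, hz, rfl⟩
      refine ⟨⟨z -ᵥ p, vsub_mem_vectorSpan ℝ hz hp⟩, ⟨_, ?_, sub_zero _⟩, rfl⟩
      simpa [Q] using hz
  apply Submodule.map_injective_of_injective (vectorSpan ℝ P).subtype_injective
  rw [Submodule.map_span, himg, ← vectorSpan_eq_span_vsub_set_right ℝ hp]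
  simp

/-- A point of a convex set that lies in no proper exposed face is a relative interior point. -/
theorem eventually_lineMap_mem_of_forall_face [FiniteDimensional ℝ V] {P : Set V}
    (hP : Convex ℝ P) {p x : V} (hp : p ∈ P) (hx : x ∈ P)
    (h : ∀ G, IsFace P G → G ≠ P → p ∉ G) :
    ∀ᶠ t in 𝓝 (0 : ℝ), AffineMap.lineMap p x t ∈ P := by
  set Q : Set (vectorSpan ℝ P) := {w | p + (w : V) ∈ P} with hQ
  have hQc : Convex ℝ Q := by
    intro a ha b hb s t hs ht hst
    have := hP ha hb hs ht hst
    have h2 : p + ((s • a + t • b : vectorSpan ℝ P) : V) = s • (p + (a : V)) + t • (p + (b : V)) := by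
      rw [smul_add, smul_add, add_add_add_comm, ← add_smul, hst, one_smul]; simp
    change p + ((s • a + t • b : vectorSpan ℝ P) : V) ∈ P
    rwa [h2]
  have hne : (interior Q).Nonempty :=
    (Convex.interior_nonempty_iff_affineSpan_eq_top hQc).2 (vectorSpan_comap_subtype_eq_top hp)
  have h0 : (0 : vectorSpan ℝ P) ∈ interior Q := by
    -- Otherwise a functional separates `0` from the interior; extended to `V`, it is maximal over
    -- `P` at `p` but not constant on `P`, so it exposes a proper face through `p`.
    by_contra h0
    obtain ⟨f, hf⟩ := geometric_hahn_banach_open_point hQc.interior isOpen_interior h0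
    rw [map_zero] at hf
    have hfQ : ∀ w ∈ Q, f w ≤ 0 := by
      intro w hw
      have : w ∈ closure (interior Q) := by
        rw [hQc.closure_interior_eq_closure_of_nonempty_interior hne]; exact subset_closure hw
      exact closure_minimal (fun w hw => (hf w hw).le) (isClosed_le f.continuous continuous_const)
        this
    obtain ⟨g, hg⟩ := LinearMap.exists_extend (f : vectorSpan ℝ P →ₗ[ℝ] ℝ)
    have hgw : ∀ w : vectorSpan ℝ P, g w = f w := fun w => LinearMap.congr_fun hg w
    have hgP : ∀ z ∈ P, g z ≤ g p := by
      intro z hz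
      have hz' := hfQ ⟨z - p, vsub_mem_vectorSpan ℝ hz hp⟩ (by simpa [hQ] using hz)
      rw [← hgw, map_sub] at hz'
      linarith
    let l := g.toContinuousLinearMap
    refine h (l.toExposed P) ContinuousLinearMap.toExposed.isExposed ?_ ⟨hp, hgP⟩
    intro heq
    obtain ⟨w, hw⟩ := hne
    have hwP : w ∈ Q := interior_subset hw
    have : p + (w : V) ∈ l.toExposed P := by rw [heq]; exact hwP
    have h1 : g p ≤ g (p + w) := this.2 p hp
    rw [map_add, hgw] at h1
    linarith [hf w hw]
  have hc : Continuous fun t : ℝ => t • (⟨x - p, vsub_mem_vectorSpan ℝ hx hp⟩ : vectorSpan ℝ P) := by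
    fun_prop
  have := hc.tendsto 0
  rw [zero_smul] at this
  filter_upwards [this (isOpen_interior.mem_nhds h0)] with t ht
  have := interior_subset ht
  rw [AffineMap.lineMap_apply, vsub_eq_sub, vadd_eq_add, add_comm]
  simpa [hQ] using this

/-- Faces of faces of a polytope are faces. -/
theorem isFace_trans {s : Set V} (hs : s.Finite) {F G : Set V} (hF : IsFace (convexHull ℝ s) F)
    (hG : IsFace F G) : IsFace (convexHull ℝ s) G := by
  intro hGne
  obtain ⟨m, hm⟩ := hG hGne
  have hGF : G ⊆ F := hG.subset
  obtain ⟨l, hl⟩ := hF (hGne.mono hGF)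
  obtain ⟨g, hg⟩ := hGne
  have hgF := hGF hg
  have hgl : ∀ y ∈ convexHull ℝ s, l y ≤ l g := by rw [hl] at hgF; exact hgF.2
  have hgm : ∀ y ∈ F, m y ≤ m g := by rw [hm] at hg; exact hg.2
  have hmemF : ∀ y ∈ convexHull ℝ s, l g ≤ l y → y ∈ F := fun y hy h => by
    rw [hl]; exact ⟨hy, fun z hz => (hgl z hz).trans h⟩
  -- On generators in `F` the functional `m` decides; on the others the strict gap in `l` absorbs a
  -- small multiple of `m`. Finiteness of `s` gives a common `e`.
  have hev : ∀ᶠ e in 𝓝[>] (0 : ℝ), ∀ z ∈ s, l z + e * m z ≤ l g + e * m g := by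
    rw [eventually_all_finite hs]
    intro z hz
    have hz' := subset_convexHull ℝ s hz
    by_cases hzF : l g ≤ l z
    · filter_upwards [self_mem_nhdsWithin] with e he
      have h1 := hgm z (hmemF z hz' hzF)
      have h2 := hgl z hz'
      have := mul_le_mul_of_nonneg_left h1 (le_of_lt he)
      linarith
    · push Not at hzF
      have hc : Tendsto (fun e : ℝ => (l z + e * m z) - (l g + e * m g)) (𝓝[>] 0)
          (𝓝 ((l z + 0 * m z) - (l g + 0 * m g))) := by
        apply tendsto_nhdsWithin_of_tendsto_nhds
        apply Continuous.tendsto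
        fun_prop
      have : (l z + 0 * m z) - (l g + 0 * m g) < 0 := by linarith
      filter_upwards [hc.eventually (gt_mem_nhds this)] with e he
      linarith
  obtain ⟨e, he, he0⟩ := (hev.and self_mem_nhdsWithin).exists
  replace he0 : 0 < e := he0
  have hle : ∀ y ∈ convexHull ℝ s, l y + e * m y ≤ l g + e * m g := by
    intro y hy
    have hconv : Convex ℝ {y | (l + e • m) y ≤ l g + e * m g} :=
      convex_halfSpace_le (l + e • m).isLinear _
    exact convexHull_min (fun z hz => by simpa using he z hz) hconv hy
  -- The functional `l + e • m` alone might also be maximal at points outside `F`. The extra `l`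
  -- forces a maximizer to maximize both summands, hence to lie in `F` and to maximize `m` there.
  refine ⟨l + (l + e • m), ?_⟩
  ext y
  have key : ∀ y, (l + (l + e • m)) y = l y + (l y + e * m y) := fun y => by simp
  constructor
  · intro hy
    have hyF := hGF hy
    have hyP := hF.subset hyF
    refine ⟨hyP, fun z hz => ?_⟩
    have h1 : l g ≤ l y := by rw [hl] at hyF; exact hyF.2 g (hF.subset hgF)
    have h2 : m g ≤ m y := by rw [hm] at hy; exact hy.2 g hgF
    have h3 := hgl z hz
    have h4 := hle z hz
    have := mul_le_mul_of_nonneg_left h2 he0.le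
    rw [key, key]
    linarith
  · rintro ⟨hyP, hy⟩
    have h1 := hy g (hF.subset hgF)
    rw [key, key] at h1
    have h3 := hgl y hyP
    have h4 := hle y hyP
    have hyF : y ∈ F := hmemF y hyP (by linarith)
    rw [hm]
    refine ⟨hyF, fun z hz => (hgm z hz).trans ?_⟩
    have : e * m g ≤ e * m y := by linarith
    exact le_of_mul_le_mul_left this he0

/-- A face containing a relative interior point of a simplex contains the simplex. -/
theorem subset_face_of_isBary_pos {P F : Set V} (hF : IsFace P F) {σ : Finset V}
    (hσ : (σ : Set V) ⊆ P) {w : V → ℝ} {p : V} (hw : IsBary σ w p) (hpos : ∀ y ∈ σ, 0 < w y)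
    (hp : p ∈ F) : (σ : Set V) ⊆ F := by
  obtain ⟨l, hl⟩ := hF ⟨p, hp⟩
  have hlp : ∀ y ∈ P, l y ≤ l p := by rw [hl] at hp; exact hp.2
  -- The maximum value `l p` is a weighted mean of the values `l y ≤ l p` with positive weights, so
  -- all of them equal it.
  have hsum : ∑ y ∈ σ, w y * (l p - l y) = 0 := by
    simp_rw [mul_sub]
    rw [Finset.sum_sub_distrib, ← Finset.sum_mul, hw.1, one_mul, ← hw.2, map_sum]
    simp [map_smul]
  have h0 := (Finset.sum_eq_zero_iff_of_nonneg fun y hy =>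
    mul_nonneg (hpos y hy).le (sub_nonneg.2 (hlp y (hσ hy)))).1 hsum
  intro y hy
  rw [hl]
  have h1 := (mul_eq_zero.1 (h0 y hy)).resolve_left (hpos y hy).ne'
  exact ⟨hσ hy, fun z hz => by linarith [hlp z hz]⟩

theorem isFace_convex {P F : Set V} (hP : Convex ℝ P) (hF : IsFace P F) : Convex ℝ F :=
  IsExposed.convex hF hP

theorem dim_le_of_subset [FiniteDimensional ℝ V] {F P : Set V} (h : F ⊆ P) : dim F ≤ dim P :=
  Submodule.finrank_mono (vectorSpan_mono ℝ h)

theorem dim_convexHull {s : Set V} : dim (convexHull ℝ s) = dim s := by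
  unfold dim
  rw [← direction_affineSpan, affineSpan_convexHull, direction_affineSpan]

theorem dim_of_affineIndependent {σ : Finset V} (hσ : AffineIndependent ℝ ((↑) : σ → V))
    (hne : σ.Nonempty) : dim (σ : Set V) + 1 = σ.card := by
  have : Fintype.card σ = (σ.card - 1) + 1 := by
    have := hne.card_pos
    rw [Fintype.card_coe]; omega
  have h := hσ.finrank_vectorSpan this
  have hr : Set.range ((↑) : σ → V) = (σ : Set V) := by simp
  rw [hr] at h
  unfold dim
  rw [h]
  have := hne.card_pos
  omega

theorem mem_affineSpan_of_dim_eq [FiniteDimensional ℝ V] {F P : Set V} (hne : F.Nonempty)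
    (h : F ⊆ P) (hd : dim P ≤ dim F) {x : V} (hx : x ∈ P) : x ∈ affineSpan ℝ F := by
  obtain ⟨a, ha⟩ := hne
  have heq : vectorSpan ℝ F = vectorSpan ℝ P :=
    Submodule.eq_of_le_of_finrank_le (vectorSpan_mono ℝ h) hd
  have h1 : x -ᵥ a ∈ (affineSpan ℝ F).direction := by
    rw [direction_affineSpan, heq]
    exact vsub_mem_vectorSpan ℝ hx (h ha)
  exact (AffineSubspace.vsub_right_mem_direction_iff_mem (subset_affineSpan ℝ F ha) x).1 h1

end Faces

end PolytopeNumbers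

namespace PolytopeNumbers

/-! ### Simplicial complexes: carriers, local structure, purity -/

section Complex

variable {V : Type*} [NormedAddCommGroup V] [NormedSpace ℝ V]

/-- A simplex with a relative interior point in another simplex is a face of the latter. -/
theorem subset_of_mem_convexHull {K : Geometry.SimplicialComplex ℝ V} {τ ρ : Finset V}
    (hτ : τ ∈ K.faces) (hρ : ρ ∈ K.faces) {w : V → ℝ} {p : V} (hw : IsBary τ w p)
    (hpos : ∀ y ∈ τ, 0 < w y) (hp : p ∈ convexHull ℝ (ρ : Set V)) : τ ⊆ ρ := by
  classical
  have h1 := K.inter_subset_convexHull hτ hρ ⟨hw.mem_convexHull fun y hy => (hpos y hy).le, hp⟩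
  rw [← Finset.coe_inter] at h1
  obtain ⟨w', hw', -⟩ := mem_convexHull_iff_isBary.1 h1
  intro y hy
  by_contra hyρ
  have := hw.unique (K.indep hτ) (hw'.extend Finset.inter_subset_left) hy
  rw [if_neg (fun h => hyρ (Finset.mem_inter.1 h).2)] at this
  exact (hpos y hy).ne' this

/-- Every point of the underlying set is a relative interior point of a simplex. -/
theorem exists_carrier {K : Geometry.SimplicialComplex ℝ V} {p : V} (hp : p ∈ K.space) :
    ∃ τ ∈ K.faces, ∃ w, IsBary τ w p ∧ ∀ y ∈ τ, 0 < w y := by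
  classical
  obtain ⟨ρ, hρ, hpρ⟩ := Geometry.SimplicialComplex.mem_space_iff.1 hp
  obtain ⟨w, hw, h0⟩ := mem_convexHull_iff_isBary.1 hpρ
  have hr : IsBary (ρ.filter fun y => w y ≠ 0) w p :=
    hw.restrict (Finset.filter_subset _ _) fun y hy hy' => by
      by_contra h; exact hy' (Finset.mem_filter.2 ⟨hy, h⟩)
  refine ⟨_, K.down_closed hρ (Finset.filter_subset _ _) ?_, w, hr, fun y hy => ?_⟩
  · rw [Finset.nonempty_iff_ne_empty]
    intro h
    have := hr.1
    rw [h, Finset.sum_empty] at this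
    exact zero_ne_one this
  · obtain ⟨hy, hne⟩ := Finset.mem_filter.1 hy
    exact lt_of_le_of_ne (h0 y hy) hne.symm

/-- If points of a line arbitrarily close to a relative interior point of a simplex are in the
complex, then they are in a simplex that contains the given one. -/
theorem exists_face_of_frequently {K : Geometry.SimplicialComplex ℝ V} (hK : K.faces.Finite)
    {τ : Finset V} (hτ : τ ∈ K.faces) {w : V → ℝ} {p : V} (hw : IsBary τ w p)
    (hpos : ∀ y ∈ τ, 0 < w y) {x : V} {l : Filter ℝ} (hl : l ≤ 𝓝 0)
    (h : ∃ᶠ t in l, AffineMap.lineMap p x t ∈ K.space) :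
    ∃ ρ ∈ K.faces, τ ⊆ ρ ∧ ∃ᶠ t in l, AffineMap.lineMap p x t ∈ convexHull ℝ (ρ : Set V) := by
  have h' : ∃ᶠ t in l, ∃ ρ ∈ K.faces, AffineMap.lineMap p x t ∈ convexHull ℝ (ρ : Set V) :=
    h.mono fun t ht => Geometry.SimplicialComplex.mem_space_iff.1 ht
  obtain ⟨ρ, hρ, hf⟩ := (frequently_exists_finite hK).1 h'
  refine ⟨ρ, hρ, subset_of_mem_convexHull hτ hρ hw hpos ?_, hf⟩
  have hc : Tendsto (fun t : ℝ => AffineMap.lineMap p x t) l (𝓝 p) := by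
    have := (AffineMap.lineMap_continuous (p := p) (q := x) (R := ℝ)).tendsto 0
    rw [AffineMap.lineMap_apply_zero] at this
    exact this.mono_left hl
  exact (ρ.finite_toSet.isClosed_convexHull (𝕜 := ℝ)).mem_of_frequently_of_tendsto hf hc

/-- This supplies the finite generating set that transitivity of faces requires. -/
theorem exists_finite_convexHull_eq {P : Set V} {K : Geometry.SimplicialComplex ℝ V}
    (hK : K.faces.Finite) (hs : K.space = P) (hP : Convex ℝ P) :
    ∃ s : Set V, s.Finite ∧ P = convexHull ℝ s := by
  refine ⟨⋃ σ ∈ K.faces, (σ : Set V), hK.biUnion fun σ _ => σ.finite_toSet, ?_⟩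
  apply Set.Subset.antisymm
  · rw [← hs]
    exact Set.iUnion₂_subset fun σ hσ => convexHull_mono
      (Set.subset_biUnion_of_mem (u := fun σ : Finset V => (σ : Set V)) hσ)
  · exact convexHull_min (Set.iUnion₂_subset fun σ hσ => hs ▸ K.subset_space hσ) hP

/-- A simplex of a complex in `P` has at most `dim P + 1` vertices. -/
theorem card_le_dim [FiniteDimensional ℝ V] {P : Set V} {K : Geometry.SimplicialComplex ℝ V}
    (hs : K.space = P) {σ : Finset V} (hσ : σ ∈ K.faces) : σ.card ≤ dim P + 1 := by
  rw [← dim_of_affineIndependent (K.indep hσ) (K.nonempty_of_mem_faces hσ)]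
  have := dim_le_of_subset (hs ▸ K.subset_space hσ : (σ : Set V) ⊆ P)
  omega

theorem mem_affineSpan_top [FiniteDimensional ℝ V] {P : Set V}
    {K : Geometry.SimplicialComplex ℝ V} (hs : K.space = P) {σ : Finset V}
    (hσ : σ ∈ K.faces) (hc : σ.card = dim P + 1) {x : V} (hx : x ∈ P) :
    x ∈ affineSpan ℝ (σ : Set V) := by
  have := dim_of_affineIndependent (K.indep hσ) (K.nonempty_of_mem_faces hσ)
  exact mem_affineSpan_of_dim_eq (K.nonempty_of_mem_faces hσ) (hs ▸ K.subset_space hσ)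
    (by omega) hx

theorem exists_notMem_affineSpan [FiniteDimensional ℝ V] {P : Set V} {σ : Finset V}
    (hσ : AffineIndependent ℝ ((↑) : σ → V)) (hne : σ.Nonempty) (h : σ.card < dim P + 1) :
    ∃ x ∈ P, x ∉ affineSpan ℝ (σ : Set V) := by
  by_contra! hall
  have h1 := vectorSpan_mono ℝ (show P ⊆ affineSpan ℝ (σ : Set V) from hall)
  have h2 : vectorSpan ℝ (affineSpan ℝ (σ : Set V) : Set V) = vectorSpan ℝ (σ : Set V) := by
    rw [← AffineSubspace.direction_eq_vectorSpan, direction_affineSpan]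
  rw [h2] at h1
  have h3 : dim P ≤ dim (σ : Set V) := Submodule.finrank_mono h1
  have := dim_of_affineIndependent hσ hne
  omega

/-- Triangulations of convex sets are pure. -/
theorem exists_top_superset [FiniteDimensional ℝ V] {P : Set V}
    {K : Geometry.SimplicialComplex ℝ V} (hK : K.faces.Finite) (hs : K.space = P)
    (hP : Convex ℝ P) {τ : Finset V} (hτ : τ ∈ K.faces) :
    ∃ σ ∈ K.faces, τ ⊆ σ ∧ σ.card = dim P + 1 := by
  obtain ⟨σ, hτσ, hmax⟩ := hK.exists_le_maximal hτ
  refine ⟨σ, hmax.prop, hτσ, ?_⟩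
  by_contra hne
  have hlt := lt_of_le_of_ne (card_le_dim hs hmax.prop) hne
  have hσne := K.nonempty_of_mem_faces hmax.prop
  -- If a maximal simplex had too small a dimension, walking from its interior towards a point of
  -- `P` outside its span would enter a strictly larger simplex.
  obtain ⟨x, hxP, hx⟩ := exists_notMem_affineSpan (K.indep hmax.prop) hσne hlt
  obtain ⟨w, p, hw, hpos⟩ := exists_isBary_pos hσne
  have hp : p ∈ P := hs ▸ K.convexHull_subset_space hmax.prop
    (hw.mem_convexHull fun y hy => (hpos y hy).le)
  have hev : ∀ᶠ t in 𝓝[>] (0 : ℝ), AffineMap.lineMap p x t ∈ K.space := by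
    filter_upwards [Ioo_mem_nhdsGT (zero_lt_one (α := ℝ))] with t ht
    rw [hs]
    exact hP.lineMap_mem hp hxP ⟨ht.1.le, ht.2.le⟩
  obtain ⟨ρ, hρ, hσρ, hf⟩ :=
    exists_face_of_frequently hK hmax.prop hw hpos nhdsWithin_le_nhds hev.frequently
  obtain ⟨t, ht, ht0⟩ := (hf.and_eventually self_mem_nhdsWithin).exists
  have hρσ : ρ ⊆ σ := hmax.le_of_ge hρ hσρ
  exact hx (lineMap_mem_affineSpan_of_mem (ne_of_gt ht0) hw.mem_affineSpan
    (affineSpan_mono ℝ (by exact_mod_cast hρσ) (convexHull_subset_affineSpan _ ht)))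

end Complex

/-! ### Visibility of facets as a sign of a coordinate -/

section Visibility

variable {V : Type*} [NormedAddCommGroup V] [NormedSpace ℝ V]

/-- From a relative interior point one can move slightly away from the vertex `u` and stay in the
simplex. This lowers the coordinate at `u` while keeping it nonnegative, so it was positive. -/
theorem isBary_pos_of_mem_intrinsicInterior {G : Finset V}
    (hG : AffineIndependent ℝ ((↑) : G → V)) {y : V}
    (hy : y ∈ intrinsicInterior ℝ (convexHull ℝ (G : Set V))) {w : V → ℝ} (hw : IsBary G w y)
    {u : V} (hu : u ∈ G) : 0 < w u := by
  classical
  have hev := eventually_lineMap_mem_of_mem_intrinsicInterior hy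
    (subset_affineSpan ℝ _ (subset_convexHull ℝ _ (Finset.mem_coe.2 hu)))
  obtain ⟨t, ht, ht0⟩ := ((hev.filter_mono nhdsWithin_le_nhds).and
    (self_mem_nhdsWithin : Set.Iio (0 : ℝ) ∈ 𝓝[<] 0)).exists
  have ht0 : t < 0 := ht0
  have h := isBary_nonneg_of_mem_convexHull hG (hw.lineMap (isBary_vertex hu) t) ht hu
  simp only [if_true] at h
  nlinarith

/-- A facet is visible from `x` if and only if the barycentric coordinate of `x` with respect to
the opposite vertex is negative. -/
theorem facetVisible_erase_iff [FiniteDimensional ℝ V] [DecidableEq V] {σ : Finset V}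
    (hσ : AffineIndependent ℝ ((↑) : σ → V)) {l : V → ℝ} {x : V} (hl : IsBary σ l x) {u : V}
    (hu : u ∈ σ) (h0 : l u ≠ 0) : FacetVisible x σ (σ.erase u) ↔ l u < 0 := by
  have hsub : σ.erase u ⊆ σ := Finset.erase_subset _ _
  have hσ' : AffineIndependent ℝ ((↑) : (σ.erase u) → V) :=
    hσ.mono (t := (σ : Set V)) (by exact_mod_cast hsub)
  constructor
  · rintro ⟨hne, hvis⟩
    by_contra hlt
    have hpos : 0 < l u := lt_of_le_of_ne (not_lt.1 hlt) h0.symm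
    obtain ⟨y, hy⟩ := (convexHull_nonempty_iff (𝕜 := ℝ).2 (Finset.coe_nonempty.2 hne)
      ).intrinsicInterior (convex_convexHull ℝ _)
    obtain ⟨w, hw, -⟩ := mem_convexHull_iff_isBary.1 (intrinsicInterior_subset hy)
    have hwpos := fun v hv => isBary_pos_of_mem_intrinsicInterior hσ' hy hw (u := v) hv
    have hw' := hw.extend hsub
    have hxy : x ≠ y := by
      rintro rfl
      have := hl.unique hσ hw' hu
      simp [h0] at this
    -- Just after leaving `y` towards `x`, the coordinate at `u` is `t * l u > 0` and the others
    -- stay near the positive `w z`: the point is in the simplex, which contradicts visibility.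
    have hev : ∀ᶠ t in 𝓝[>] (0 : ℝ), ∀ z ∈ σ,
        0 ≤ (1 - t) * (if z ∈ σ.erase u then w z else 0) + t * l z := by
      rw [Finset.eventually_all]
      intro z hz
      by_cases hzu : z = u
      · subst hzu
        filter_upwards [self_mem_nhdsWithin] with t ht
        have ht : 0 < t := ht
        simp only [Finset.notMem_erase, if_false, mul_zero, zero_add]
        positivity
      · have hz' : z ∈ σ.erase u := Finset.mem_erase.2 ⟨hzu, hz⟩
        simp only [hz', if_true]
        have hc : Tendsto (fun t : ℝ => (1 - t) * w z + t * l z) (𝓝[>] 0)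
            (𝓝 ((1 - 0) * w z + 0 * l z)) := by
          apply tendsto_nhdsWithin_of_tendsto_nhds
          apply Continuous.tendsto (f := fun t : ℝ => (1 - t) * w z + t * l z)
          fun_prop
        have hp : 0 < (1 - 0) * w z + 0 * l z := by simpa using hwpos z hz'
        filter_upwards [hc.eventually (lt_mem_nhds hp)] with t ht using ht.le
    obtain ⟨t, ht, ht01⟩ := (hev.and (Ioo_mem_nhdsGT (zero_lt_one (α := ℝ)))).exists
    refine ((isVisible_iff_lineMap hxy.symm).1 (isVisible_comm.1 (hvis y hy)) t ht01) ?_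
    exact (hw'.lineMap hl t).mem_convexHull ht
  · intro hneg
    refine ⟨?_, fun y hy => ?_⟩
    · by_contra hne
      rw [Finset.not_nonempty_iff_eq_empty, Finset.erase_eq_empty_iff] at hne
      have h1 := hl.1
      rcases hne with h | h
      · simp [h] at hu
      · rw [h, Finset.sum_singleton] at h1
        linarith
    · obtain ⟨w, hw, -⟩ := mem_convexHull_iff_isBary.1 (intrinsicInterior_subset hy)
      have hw' := hw.extend hsub
      have hxy : x ≠ y := by
        rintro rfl
        have := hl.unique hσ hw' hu
        simp [h0] at this
      rw [isVisible_comm, isVisible_iff_lineMap hxy.symm]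
      intro t ht hmem
      have := isBary_nonneg_of_mem_convexHull hσ (hw'.lineMap hl t) hmem hu
      simp only [Finset.notMem_erase, if_false, mul_zero, zero_add] at this
      nlinarith [ht.1]

/-- The coordinates of a generic point with respect to a top simplex do not vanish. -/
theorem IsGeneric.coord_ne_zero {P : Set V} {K : Geometry.SimplicialComplex ℝ V} {x : V}
    (hx : IsGeneric P K x) {σ : Finset V} (hσ : σ ∈ K.faces) (hc : σ.card = dim P + 1)
    {l : V → ℝ} (hl : IsBary σ l x) {u : V} (hu : u ∈ σ) : l u ≠ 0 := by
  classical
  intro h0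
  have hr : IsBary (σ.erase u) l x := hl.restrict (Finset.erase_subset _ _) fun y hy hy' => by
    rw [Finset.mem_erase] at hy'
    have : y = u := by by_contra h; exact hy' ⟨h, hy⟩
    rwa [this]
  have hne : (σ.erase u).Nonempty := by
    rw [Finset.nonempty_iff_ne_empty]
    intro h
    have := hr.1
    rw [h, Finset.sum_empty] at this
    exact zero_ne_one this
  refine hx.2 _ (K.down_closed hσ (Finset.erase_subset _ _) hne) ?_ hr.mem_affineSpan
  rw [Finset.card_erase_of_mem hu]
  have := Finset.card_pos.2 ⟨u, hu⟩
  omega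

theorem mem_oppNotVisible_iff [FiniteDimensional ℝ V] {P : Set V}
    {K : Geometry.SimplicialComplex ℝ V} {x : V}
    (hx : IsGeneric P K x) {σ : Finset V} (hσ : σ ∈ K.faces) (hc : σ.card = dim P + 1)
    {l : V → ℝ} (hl : IsBary σ l x) {u : V} :
    u ∈ oppNotVisible x σ ↔ u ∈ σ ∧ 0 < l u := by
  classical
  simp only [oppNotVisible, Finset.mem_filter]
  refine and_congr_right fun hu => ?_
  have h0 := hx.coord_ne_zero hσ hc hl hu
  have := facetVisible_erase_iff (K.indep hσ) hl hu h0
  have h2 : ¬ FacetVisible x σ (σ.erase u) ↔ 0 < l u := by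
    rw [this, not_lt]
    exact ⟨fun h => lt_of_le_of_ne h h0.symm, le_of_lt⟩
  exact h2

theorem oppNotVisible_subset (x : V) (σ : Finset V) : oppNotVisible x σ ⊆ σ := by
  classical
  exact Finset.filter_subset _ _

/-- The coordinates of `x` sum to `1`, so one is positive. Consequently the empty simplex is in no
interval `[D_σ, σ]`. -/
theorem oppNotVisible_nonempty [FiniteDimensional ℝ V] {P : Set V}
    {K : Geometry.SimplicialComplex ℝ V} (hs : K.space = P) {x : V}
    (hx : IsGeneric P K x) {σ : Finset V} (hσ : σ ∈ K.faces) (hc : σ.card = dim P + 1) :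
    (oppNotVisible x σ).Nonempty := by
  obtain ⟨l, hl⟩ := mem_affineSpan_iff_isBary.1 (mem_affineSpan_top hs hσ hc hx.1)
  obtain ⟨u, hu, hpos⟩ : ∃ u ∈ σ, 0 < l u := by
    apply Finset.exists_lt_of_sum_lt
    rw [hl.1, Finset.sum_const_zero]
    exact zero_lt_one
  exact ⟨u, (mem_oppNotVisible_iff hx hσ hc hl).2 ⟨hu, hpos⟩⟩

end Visibility

/-! ### The partition of the interior simplices into intervals -/

section Partition

variable {V : Type*} [NormedAddCommGroup V] [NormedSpace ℝ V]

/-- Going from a point of the relative interior of `τ ∈ [D_σ, σ]` away from `x`, one enters the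
interior of `σ`. -/
theorem eventually_coord_pos [FiniteDimensional ℝ V] {P : Set V}
    {K : Geometry.SimplicialComplex ℝ V} {x : V}
    (hx : IsGeneric P K x) {σ τ : Finset V} (hσ : σ ∈ K.faces) (hc : σ.card = dim P + 1)
    {l : V → ℝ} (hl : IsBary σ l x) (hD : oppNotVisible x σ ⊆ τ) {w : V → ℝ}
    (hpos : ∀ y ∈ τ, 0 < w y) [DecidableEq V] :
    ∀ᶠ t in 𝓝[<] (0 : ℝ), ∀ z ∈ σ, 0 < (1 - t) * (if z ∈ τ then w z else 0) + t * l z := by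
  rw [Finset.eventually_all]
  intro z hz
  by_cases hzτ : z ∈ τ
  · simp only [hzτ, if_true]
    have hct : Tendsto (fun t : ℝ => (1 - t) * w z + t * l z) (𝓝[<] 0)
        (𝓝 ((1 - 0) * w z + 0 * l z)) := by
      apply tendsto_nhdsWithin_of_tendsto_nhds
      apply Continuous.tendsto (f := fun t : ℝ => (1 - t) * w z + t * l z)
      fun_prop
    have hp : 0 < (1 - 0) * w z + 0 * l z := by simpa using hpos z hzτ
    exact hct.eventually (lt_mem_nhds hp)
  · have h1 : ¬ 0 < l z := fun h => hzτ (hD ((mem_oppNotVisible_iff hx hσ hc hl).2 ⟨hz, h⟩))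
    have h2 : l z < 0 := lt_of_le_of_ne (not_lt.1 h1) (hx.coord_ne_zero hσ hc hl hz)
    filter_upwards [self_mem_nhdsWithin] with t ht
    have ht : t < 0 := ht
    simp only [hzτ, if_false, mul_zero, zero_add]
    exact mul_pos_of_neg_of_neg ht h2

/-- If `τ` is in two intervals, one point slightly beyond `τ`, as seen from `x`, is interior to both
top simplices, which therefore coincide. -/
theorem pairwiseDisjoint_Icc_oppNotVisible [FiniteDimensional ℝ V] {P : Set V}
    {K : Geometry.SimplicialComplex ℝ V} (hs : K.space = P) {x : V} (hx : IsGeneric P K x) :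
    (topSimplices P K).PairwiseDisjoint (fun σ => Set.Icc (oppNotVisible x σ) σ) := by
  classical
  intro σ hσ σ' hσ' hne
  rw [Function.onFun, Set.disjoint_left]
  rintro τ ⟨hD, hτσ⟩ ⟨hD', hτσ'⟩
  apply hne
  have hτne : τ.Nonempty := (oppNotVisible_nonempty hs hx hσ.1 hσ.2).mono hD
  obtain ⟨w, p, hw, hpos⟩ := exists_isBary_pos hτne
  obtain ⟨l, hl⟩ := mem_affineSpan_iff_isBary.1 (mem_affineSpan_top hs hσ.1 hσ.2 hx.1)
  obtain ⟨l', hl'⟩ := mem_affineSpan_iff_isBary.1 (mem_affineSpan_top hs hσ'.1 hσ'.2 hx.1)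
  obtain ⟨t, h1, h2⟩ := ((eventually_coord_pos hx hσ.1 hσ.2 hl hD hpos).and
    (eventually_coord_pos hx hσ'.1 hσ'.2 hl' hD' hpos)).exists
  have hb := (hw.extend hτσ).lineMap hl t
  have hb' := (hw.extend hτσ').lineMap hl' t
  exact (subset_of_mem_convexHull hσ.1 hσ'.1 hb h1 (hb'.mem_convexHull fun y hy => (h2 y hy).le)
    ).antisymm (subset_of_mem_convexHull hσ'.1 hσ.1 hb' h2
      (hb.mem_convexHull fun y hy => (h1 y hy).le))

/-- A face of `P` that contains a top simplex is `P`. -/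
theorem face_eq_of_top_subset [FiniteDimensional ℝ V] {P : Set V}
    {K : Geometry.SimplicialComplex ℝ V} {σ : Finset V} (hσ : σ ∈ K.faces)
    (hc : σ.card = dim P + 1) {G : Set V} (hG : IsFace P G) (hsub : (σ : Set V) ⊆ G) : G = P := by
  by_contra hne
  have h1 := dim_lt_of_mem_properFaces (P := P) (F := G)
    ⟨hG, (Finset.coe_nonempty.2 (K.nonempty_of_mem_faces hσ)).mono hsub, hne⟩
  have h2 := dim_le_of_subset hsub
  have h3 := dim_of_affineIndependent (K.indep hσ) (K.nonempty_of_mem_faces hσ)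
  omega

theorem interiorSimplices_eq_iUnion [FiniteDimensional ℝ V] {P : Set V}
    {K : Geometry.SimplicialComplex ℝ V} (hK : K.faces.Finite) (hs : K.space = P)
    (hP : Convex ℝ P) {x : V} (hx : IsGeneric P K x) :
    interiorSimplices P K = ⋃ σ ∈ topSimplices P K, Set.Icc (oppNotVisible x σ) σ := by
  classical
  ext τ
  rw [Set.mem_iUnion₂]
  constructor
  · rintro ⟨hτ, hint⟩
    obtain ⟨w, p, hw, hpos⟩ := exists_isBary_pos (K.nonempty_of_mem_faces hτ)
    have hτP : (τ : Set V) ⊆ P := hs ▸ K.subset_space hτ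
    have hp : p ∈ P := hs ▸ K.convexHull_subset_space hτ
      (hw.mem_convexHull fun y hy => (hpos y hy).le)
    have hev := eventually_lineMap_mem_of_forall_face hP hp hx.1 fun G hG hGP hpG =>
      hint G hG hGP (convexHull_min (subset_face_of_isBary_pos hG hτP hw hpos hpG)
        (isFace_convex hP hG))
    rw [← hs] at hev
    obtain ⟨ρ, hρ, hτρ, hf⟩ := exists_face_of_frequently hK hτ hw hpos
      (nhdsWithin_le_nhds (s := Set.Iio 0)) (hev.filter_mono nhdsWithin_le_nhds).frequently
    obtain ⟨t, ht, ht0⟩ := (hf.and_eventually self_mem_nhdsWithin).exists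
    have ht0 : t < 0 := ht0
    -- The span of `ρ` contains `p` and a second point of the line through `x`, hence `x`; general
    -- position then forces `ρ` to be a top simplex.
    have hxρ : x ∈ affineSpan ℝ (ρ : Set V) :=
      lineMap_mem_affineSpan_of_mem ht0.ne (hw.extend hτρ).mem_affineSpan
        (convexHull_subset_affineSpan _ ht)
    have hc : ρ.card = dim P + 1 := by
      by_contra hne
      exact hx.2 ρ hρ (lt_of_le_of_ne (card_le_dim hs hρ) hne) hxρ
    obtain ⟨l, hl⟩ := mem_affineSpan_iff_isBary.1 hxρ
    refine ⟨ρ, ⟨hρ, hc⟩, fun u hu => ?_, hτρ⟩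
    obtain ⟨huρ, hlu⟩ := (mem_oppNotVisible_iff hx hρ hc hl).1 hu
    by_contra huτ
    have := isBary_nonneg_of_mem_convexHull (K.indep hρ) ((hw.extend hτρ).lineMap hl t) ht huρ
    simp only [huτ, if_false, mul_zero, zero_add] at this
    nlinarith
  · rintro ⟨σ, ⟨hσ, hc⟩, hD, hτσ⟩
    have hτne : τ.Nonempty := (oppNotVisible_nonempty hs hx hσ hc).mono hD
    have hτ := K.down_closed hσ hτσ hτne
    refine ⟨hτ, fun G hG hGP hsub => hGP (face_eq_of_top_subset hσ hc hG ?_)⟩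
    obtain ⟨w, p, hw, hpos⟩ := exists_isBary_pos hτne
    obtain ⟨l, hl⟩ := mem_affineSpan_iff_isBary.1 (mem_affineSpan_top hs hσ hc hx.1)
    obtain ⟨t, h1, ht0⟩ := ((eventually_coord_pos hx hσ hc hl hD hpos).and
      self_mem_nhdsWithin).exists
    have ht0 : t < 0 := ht0
    have hσP : (σ : Set V) ⊆ P := hs ▸ K.subset_space hσ
    have hb := (hw.extend hτσ).lineMap hl t
    refine subset_face_of_isBary_pos hG hσP hb h1 ?_
    have hq : AffineMap.lineMap p x t ∈ P := hs ▸ K.convexHull_subset_space hσ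
      (hb.mem_convexHull fun y hy => (h1 y hy).le)
    have hpG : p ∈ G := hsub (hw.mem_convexHull fun y hy => (hpos y hy).le)
    refine (IsExposed.isExtreme hG).2 hq hx.1 hpG ?_
    rw [openSegment_eq_image_lineMap]
    -- With `q = (1 - t) p + t x`, the point `p` is `(1 - s) q + s x` exactly when `(1 - s) (1 - t)
    -- = 1`, which gives this `s`.
    refine ⟨-t / (1 - t), ⟨by apply div_pos <;> linarith, ?_⟩, ?_⟩
    · rw [div_lt_one (by linarith)]; linarith
    · rw [AffineMap.lineMap_lineMap_left]
      have : 1 - (1 - -t / (1 - t)) * (1 - t) = 0 := by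
        have : 1 - t ≠ 0 := by linarith
        field_simp
        ring
      rw [this, AffineMap.lineMap_apply_zero]

end Partition

end PolytopeNumbers

namespace PolytopeNumbers

/-! ### Induced triangulations of faces and carriers of simplices -/

section Restriction

variable {V : Type*} [NormedAddCommGroup V] [NormedSpace ℝ V]

/-- The triangulation of a face that is induced by `K`, as a simplicial complex. -/
def restrictComplex (K : Geometry.SimplicialComplex ℝ V) (F : Set V) :
    Geometry.SimplicialComplex ℝ V where
  faces := inducedFaces K F
  indep hσ := K.indep hσ.1
  isRelLowerSet_faces := fun _ hσ => ⟨K.nonempty_of_mem_faces hσ.1, fun _ hτσ hτ =>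
    ⟨K.down_closed hσ.1 hτσ hτ, (convexHull_mono (by exact_mod_cast hτσ)).trans hσ.2⟩⟩
  inter_subset_convexHull hσ hτ := K.inter_subset_convexHull hσ.1 hτ.1

/-- A finite triangulation `K` of the convex set `P` in which the apex of every face is in all the
top simplices of the induced triangulation of the face. -/
structure IsConeTriangulation (P : Set V) (v : Set V → V) (K : Geometry.SimplicialComplex ℝ V) :
    Prop where
  finite_faces : K.faces.Finite
  space_eq : K.space = P
  convex : Convex ℝ P
  apex_vertex : IsApexChoice P v
  apex_mem : ∀ F, IsFace P F → F.Nonempty → ∀ σ ∈ inducedFaces K F, σ.card = dim F + 1 →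
    v F ∈ convexHull ℝ (σ : Set V)

theorem space_restrictComplex {P : Set V} {K : Geometry.SimplicialComplex ℝ V}
    (hs : K.space = P) (hP : Convex ℝ P) {F : Set V} (hF : IsFace P F) :
    (restrictComplex K F).space = F := by
  ext p
  rw [Geometry.SimplicialComplex.mem_space_iff]
  constructor
  · rintro ⟨σ, hσ, hp⟩
    exact hσ.2 hp
  · intro hp
    obtain ⟨τ, hτ, w, hw, hpos⟩ := exists_carrier (hs.symm ▸ hF.subset hp : p ∈ K.space)
    exact ⟨τ, ⟨hτ, convexHull_min (subset_face_of_isBary_pos hF (hs ▸ K.subset_space hτ) hw hpos hp)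
      (isFace_convex hP hF)⟩, hw.mem_convexHull fun y hy => (hpos y hy).le⟩

variable {P : Set V} {v : Set V → V} {K : Geometry.SimplicialComplex ℝ V}

theorem IsConeTriangulation.isFace_trans (h : IsConeTriangulation P v K) {F G : Set V}
    (hF : IsFace P F) (hG : IsFace F G) : IsFace P G := by
  obtain ⟨s, hs, rfl⟩ := exists_finite_convexHull_eq h.finite_faces h.space_eq h.convex
  exact PolytopeNumbers.isFace_trans hs hF hG

theorem IsConeTriangulation.restrict (h : IsConeTriangulation P v K) {F : Set V}
    (hF : IsFace P F) : IsConeTriangulation F v (restrictComplex K F) where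
  finite_faces := h.finite_faces.subset fun _ hσ => hσ.1
  space_eq := space_restrictComplex h.space_eq h.convex hF
  convex := isFace_convex h.convex hF
  apex_vertex G hG := h.apex_vertex G (h.isFace_trans hF hG)
  apex_mem G hG hne σ hσ := h.apex_mem G (h.isFace_trans hF hG) hne σ ⟨hσ.1.1, hσ.2⟩

theorem IsConeTriangulation.finite_properFaces (h : IsConeTriangulation P v K) :
    (properFaces P).Finite := by
  refine Set.Finite.of_injOn (f := inducedFaces K) (t := 𝒫 K.faces) (fun F _ _ hσ => hσ.1) ?_
    h.finite_faces.finite_subsets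
  intro F hF G hG hFG
  rw [← space_restrictComplex h.space_eq h.convex hF.1,
    ← space_restrictComplex h.space_eq h.convex hG.1]
  unfold Geometry.SimplicialComplex.space
  change ⋃ σ ∈ inducedFaces K F, _ = ⋃ σ ∈ inducedFaces K G, _
  simp only [hFG]

/-- The apex is an extreme point of `P`, so it is extreme in any simplex containing it, that is, one
of its vertices. -/
theorem IsConeTriangulation.apex_mem_top (h : IsConeTriangulation P v K) (hne : P.Nonempty)
    {σ : Finset V} (hσ : σ ∈ K.faces) (hc : σ.card = dim P + 1) : v P ∈ σ := by
  have hsub : convexHull ℝ (σ : Set V) ⊆ P := h.space_eq ▸ K.convexHull_subset_space hσ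
  have h1 := h.apex_mem P (IsExposed.refl P) hne σ ⟨hσ, hsub⟩ hc
  have h2 := h.apex_vertex P (IsExposed.refl P) hne
  exact extremePoints_convexHull_subset (inter_extremePoints_subset_extremePoints_of_subset hsub
    ⟨h1, h2⟩)

/-- The smallest face of `P` that contains the simplex `τ` of `K`. -/
noncomputable def carrierFace (P : Set V) (K : Geometry.SimplicialComplex ℝ V) (τ : Finset V) :
    Set V :=
  Classical.epsilon fun F => IsFace P F ∧ τ ∈ interiorSimplices F (restrictComplex K F)

theorem carrierFace_spec [FiniteDimensional ℝ V] (h : IsConeTriangulation P v K) {τ : Finset V}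
    (hτ : τ ∈ K.faces) : IsFace P (carrierFace P K τ) ∧
      τ ∈ interiorSimplices (carrierFace P K τ) (restrictComplex K (carrierFace P K τ)) := by
  have hτne := K.nonempty_of_mem_faces hτ
  apply Classical.epsilon_spec
    (p := fun F => IsFace P F ∧ τ ∈ interiorSimplices F (restrictComplex K F))
  obtain ⟨F, ⟨hF, hτF⟩, hmin⟩ := WellFounded.has_min (measure (dim : Set V → ℕ)).wf
    {F | IsFace P F ∧ convexHull ℝ (τ : Set V) ⊆ F}
    ⟨P, IsExposed.refl P, h.space_eq ▸ K.convexHull_subset_space hτ⟩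
  refine ⟨F, hF, ⟨hτ, hτF⟩, fun G hG hGF hτG => ?_⟩
  have hGne : G.Nonempty :=
    (convexHull_nonempty_iff (𝕜 := ℝ).2 (Finset.coe_nonempty.2 hτne)).mono hτG
  exact hmin G ⟨h.isFace_trans hF hG, hτG⟩ (dim_lt_of_mem_properFaces ⟨hG, hGne, hGF⟩)

theorem eq_of_mem_interiorSimplices {τ : Finset V} {F G : Set V}
    (hF : IsFace P F) (hG : IsFace P G) (hτF : τ ∈ interiorSimplices F (restrictComplex K F))
    (hτG : τ ∈ interiorSimplices G (restrictComplex K G)) : F = G := by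
  have hFG : IsFace P (F ∩ G) := IsExposed.inter hF hG
  have hsub : convexHull ℝ (τ : Set V) ⊆ F ∩ G := Set.subset_inter hτF.1.2 hτG.1.2
  have h1 : F ∩ G = F := by
    by_contra hne
    exact hτF.2 _ (IsExposed.mono hFG hF.subset Set.inter_subset_left) hne hsub
  have h2 : F ∩ G = G := by
    by_contra hne
    exact hτG.2 _ (IsExposed.mono hFG hG.subset Set.inter_subset_right) hne hsub
  rw [← h1, h2]

theorem mem_interiorSimplices_iff_carrierFace [FiniteDimensional ℝ V]
    (h : IsConeTriangulation P v K) {τ : Finset V} {F : Set V} (hF : IsFace P F) :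
    τ ∈ interiorSimplices F (restrictComplex K F) ↔ τ ∈ K.faces ∧ carrierFace P K τ = F := by
  constructor
  · intro hτ
    have hs := carrierFace_spec h hτ.1.1
    exact ⟨hτ.1.1, eq_of_mem_interiorSimplices hs.1 hF hs.2 hτ⟩
  · rintro ⟨hτ, rfl⟩
    exact (carrierFace_spec h hτ).2

theorem mem_interiorSimplices_self_iff [FiniteDimensional ℝ V]
    (h : IsConeTriangulation P v K) {τ : Finset V} :
    τ ∈ interiorSimplices P K ↔ τ ∈ K.faces ∧ carrierFace P K τ = P := by
  rw [← mem_interiorSimplices_iff_carrierFace h (IsExposed.refl P)]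
  constructor
  · rintro ⟨hτ, hint⟩
    exact ⟨⟨hτ, h.space_eq ▸ K.convexHull_subset_space hτ⟩, hint⟩
  · rintro ⟨hτ, hint⟩
    exact ⟨hτ.1, hint⟩

theorem carrierFace_mem_properFaces [FiniteDimensional ℝ V] (h : IsConeTriangulation P v K)
    {τ : Finset V} (hτ : τ ∈ K.faces) (hne : carrierFace P K τ ≠ P) :
    carrierFace P K τ ∈ properFaces P := by
  have hs := carrierFace_spec h hτ
  exact ⟨hs.1, (convexHull_nonempty_iff (𝕜 := ℝ).2
    (Finset.coe_nonempty.2 (K.nonempty_of_mem_faces hτ))).mono hs.2.1.2, hne⟩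

theorem finsum_interiorSimplices [FiniteDimensional ℝ V] [DecidableEq (Set V)]
    (h : IsConeTriangulation P v K) {F : Set V} (hF : IsFace P F) (g : Finset V → ℤ) :
    ∑ᶠ τ ∈ interiorSimplices F (restrictComplex K F), g τ =
      ∑ τ ∈ h.finite_faces.toFinset with carrierFace P K τ = F, g τ := by
  rw [← finsum_mem_coe_finset]
  refine finsum_mem_congr (Set.ext fun τ => ?_) fun _ _ => rfl
  rw [mem_interiorSimplices_iff_carrierFace h hF]; simp

theorem finsum_interiorSimplices_self [FiniteDimensional ℝ V] [DecidableEq (Set V)]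
    (h : IsConeTriangulation P v K) (g : Finset V → ℤ) :
    ∑ᶠ τ ∈ interiorSimplices P K, g τ =
      ∑ τ ∈ h.finite_faces.toFinset with carrierFace P K τ = P, g τ := by
  rw [← finsum_mem_coe_finset]
  refine finsum_mem_congr (Set.ext fun τ => ?_) fun _ _ => rfl
  rw [mem_interiorSimplices_self_iff h]; simp

/-- Grouping the simplices by carrier turns the sums over faces in the recursion into sums over
simplices. -/
theorem finsum_properFaces [FiniteDimensional ℝ V] [DecidableEq (Set V)] (h : IsConeTriangulation P v K)
    (g : Finset V → ℤ) (q : Set V → Prop) [DecidablePred q] :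
    ∑ᶠ F : properFaces P,
      (if q F then ∑ᶠ τ ∈ interiorSimplices F.1 (restrictComplex K F), g τ else 0) =
      ∑ τ ∈ h.finite_faces.toFinset with carrierFace P K τ ≠ P ∧ q (carrierFace P K τ), g τ := by
  rw [finsum_set_coe_eq_finsum_mem (properFaces P) (f := fun F =>
      if q F then ∑ᶠ τ ∈ interiorSimplices F (restrictComplex K F), g τ else 0),
    finsum_mem_eq_finite_toFinset_sum _ h.finite_properFaces,
    ← Finset.sum_fiberwise_of_maps_to (g := carrierFace P K)
      (t := h.finite_properFaces.toFinset) (by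
        intro τ hτ
        simp only [Finset.mem_filter, Set.Finite.mem_toFinset] at hτ ⊢
        exact carrierFace_mem_properFaces h hτ.1 hτ.2.1)]
  refine Finset.sum_congr rfl fun F hF => ?_
  rw [Set.Finite.mem_toFinset] at hF
  rw [Finset.filter_filter]
  split_ifs with hq
  · rw [finsum_interiorSimplices h hF.1]
    refine Finset.sum_congr (Finset.filter_congr fun τ _ => ?_) fun _ _ => rfl
    constructor
    · rintro rfl
      exact ⟨⟨hF.2.2, hq⟩, rfl⟩
    · exact fun h => h.2
  · symm
    apply Finset.sum_eq_zero
    intro τ hτ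
    rw [Finset.mem_filter] at hτ
    obtain ⟨-, ⟨-, hq'⟩, rfl⟩ := hτ
    exact absurd hq' hq

end Restriction

/-! ### The recursion solved on a cone triangulation -/

section Cone

variable {V : Type*} [NormedAddCommGroup V] [NormedSpace ℝ V] [FiniteDimensional ℝ V]
  {P : Set V} {v : Set V → V} {K : Geometry.SimplicialComplex ℝ V}

theorem IsConeTriangulation.insert_apex_mem [DecidableEq V] (h : IsConeTriangulation P v K)
    (hne : P.Nonempty) {τ : Finset V} (hτ : τ ∈ K.faces) : insert (v P) τ ∈ K.faces := by
  obtain ⟨σ, hσ, hτσ, hc⟩ := exists_top_superset h.finite_faces h.space_eq h.convex hτ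
  exact K.down_closed hσ (Finset.insert_subset (h.apex_mem_top hne hσ hc) hτσ)
    (Finset.insert_nonempty _ _)

theorem IsConeTriangulation.singleton_apex_mem (h : IsConeTriangulation P v K)
    (hne : P.Nonempty) : {v P} ∈ K.faces := by
  classical
  obtain ⟨p, hp⟩ := hne
  obtain ⟨τ, hτ, -⟩ := Geometry.SimplicialComplex.mem_space_iff.1 (h.space_eq.symm ▸ hp)
  exact K.down_closed (h.insert_apex_mem ⟨p, hp⟩ hτ)
    (Finset.singleton_subset_iff.2 (Finset.mem_insert_self _ _)) (Finset.singleton_nonempty _)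

/-- A simplex contains the apex of `P` if and only if its carrier does. -/
theorem IsConeTriangulation.apex_mem_iff (h : IsConeTriangulation P v K) (hne : P.Nonempty)
    {τ : Finset V} (hτ : τ ∈ K.faces) : v P ∈ carrierFace P K τ ↔ v P ∈ τ := by
  classical
  obtain ⟨hF, hint⟩ := carrierFace_spec h hτ
  set F := carrierFace P K τ
  constructor
  · intro hv
    -- Otherwise one could step from `p` away from the apex within the carrier and remain in a
    -- simplex `ρ ⊇ τ`; in the cone over `ρ` the coordinate at the apex would be `t < 0`.
    by_contra hvτ
    have hFc := isFace_convex h.convex hF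
    obtain ⟨w, p, hw, hpos⟩ := exists_isBary_pos (K.nonempty_of_mem_faces hτ)
    have hpτ := hw.mem_convexHull fun y hy => (hpos y hy).le
    have hτF : (τ : Set V) ⊆ F := (subset_convexHull ℝ _).trans hint.1.2
    have hev := eventually_lineMap_mem_of_forall_face hFc (hint.1.2 hpτ) hv
      fun G hG hGF hpG => hint.2 G hG hGF
        (convexHull_min (subset_face_of_isBary_pos hG hτF hw hpos hpG) (isFace_convex hFc hG))
    have hev' : ∀ᶠ t in 𝓝 (0 : ℝ), AffineMap.lineMap p (v P) t ∈ K.space := by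
      filter_upwards [hev] with t ht
      rw [h.space_eq]
      exact hF.subset ht
    obtain ⟨ρ, hρ, hτρ, hf⟩ := exists_face_of_frequently h.finite_faces hτ hw hpos
      (nhdsWithin_le_nhds (s := Set.Iio 0)) (hev'.filter_mono nhdsWithin_le_nhds).frequently
    obtain ⟨t, ht, ht0⟩ := (hf.and_eventually self_mem_nhdsWithin).exists
    have ht0 : t < 0 := ht0
    have hσ := h.insert_apex_mem hne hρ
    have hvσ := Finset.mem_insert_self (v P) ρ
    have hb := (hw.extend (hτρ.trans (Finset.subset_insert (v P) ρ))).lineMap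
      (isBary_vertex hvσ) t
    have := isBary_nonneg_of_mem_convexHull (K.indep hσ) hb
      (convexHull_mono (by exact_mod_cast Finset.subset_insert (v P) ρ) ht) hvσ
    simp only [hvτ, if_false, mul_zero, zero_add, if_true, mul_one] at this
    linarith
  · intro hv
    exact hint.1.2 (subset_convexHull ℝ _ hv)

-- Pair each `τ` avoiding the apex with its cone and apply Pascal's rule. The leading `1` is the
-- cone over the empty simplex. By `numberRec_eq` the right side is `P(n+2)` when `dim P > 0`.
open Classical in
theorem IsConeTriangulation.sum_choose (h : IsConeTriangulation P v K) (hne : P.Nonempty)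
    (n : ℕ) : ∑ τ ∈ h.finite_faces.toFinset, (n.choose (τ.card - 1) : ℤ) =
      1 + ∑ τ ∈ h.finite_faces.toFinset with v P ∉ τ, ((n + 1).choose τ.card : ℤ) := by
  set S := h.finite_faces.toFinset with hS
  have hmem : ∀ {τ}, τ ∈ S ↔ τ ∈ K.faces := fun {τ} => Set.Finite.mem_toFinset _
  have himg : S.filter (fun τ => v P ∈ τ) =
      (insert ∅ (S.filter fun τ => v P ∉ τ)).image (insert (v P)) := by
    ext τ
    simp only [Finset.mem_filter, Finset.mem_image, Finset.mem_insert, hmem]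
    constructor
    · rintro ⟨hτ, hv⟩
      refine ⟨τ.erase (v P), ?_, Finset.insert_erase hv⟩
      rcases (τ.erase (v P)).eq_empty_or_nonempty with he | he
      · exact Or.inl he
      · exact Or.inr ⟨K.down_closed hτ (Finset.erase_subset _ _) he, Finset.notMem_erase _ _⟩
    · rintro ⟨ρ, rfl | ⟨hρ, -⟩, rfl⟩
      · exact ⟨by simpa using h.singleton_apex_mem hne, by simp⟩
      · exact ⟨h.insert_apex_mem hne hρ, Finset.mem_insert_self _ _⟩
  have hnot : ∀ ρ ∈ insert ∅ (S.filter fun τ => v P ∉ τ), v P ∉ ρ := by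
    intro ρ hρ
    rcases Finset.mem_insert.1 hρ with rfl | hρ
    · simp
    · exact (Finset.mem_filter.1 hρ).2
  rw [← Finset.sum_filter_add_sum_filter_not S (fun τ => v P ∈ τ), himg, Finset.sum_image,
    Finset.sum_insert]
  · rw [add_assoc, ← Finset.sum_add_distrib]
    congr 1
    · simp
    · refine Finset.sum_congr rfl fun τ hτ => ?_
      obtain ⟨hτ, hv⟩ := Finset.mem_filter.1 hτ
      rw [Finset.card_insert_of_notMem hv, Nat.add_sub_cancel]
      obtain ⟨k, hk⟩ : ∃ k, τ.card = k + 1 :=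
        Nat.exists_eq_succ_of_ne_zero (K.nonempty_of_mem_faces (hmem.1 hτ)).card_pos.ne'
      rw [hk, Nat.choose_succ_succ, Nat.add_sub_cancel]
      push_cast
      ring
  · rw [Finset.mem_filter, hmem]
    exact fun h => K.empty_notMem h.1
  · intro a ha b hb hab
    have := congrArg (fun s => Finset.erase s (v P)) hab
    simpa [Finset.erase_insert (hnot a ha), Finset.erase_insert (hnot b hb)] using this

open Classical in
/-- The recursion for polytope numbers, solved in terms of the triangulation. -/
theorem IsConeTriangulation.numberRec_eq (h : IsConeTriangulation P v K) (hne : P.Nonempty)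
    (I : properFaces P → ℕ → ℤ)
    (hI : ∀ F n, I F (n + 2) = ∑ᶠ τ ∈ interiorSimplices F.1 (restrictComplex K F),
      (n.choose (τ.card - 1) : ℤ)) (n : ℕ) :
    numberRec v P I (n + 1) =
      1 + ∑ τ ∈ h.finite_faces.toFinset with v P ∉ τ, (n.choose τ.card : ℤ) := by
  induction n with
  | zero =>
    rw [Finset.sum_eq_zero]
    · simp [numberRec]
    · intro τ hτ
      rw [Finset.mem_filter, Set.Finite.mem_toFinset] at hτ
      rw [Nat.choose_eq_zero_of_lt (K.nonempty_of_mem_faces hτ.1).card_pos, Nat.cast_zero]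
  | succ n ih =>
    have hvP : v P ∈ P := (h.apex_vertex P (IsExposed.refl P) hne).1
    rw [numberRec, ih]
    simp_rw [hI]
    rw [finsum_properFaces h (fun τ => (n.choose (τ.card - 1) : ℤ)) (fun F => v P ∉ F)]
    have hf : (h.finite_faces.toFinset.filter fun τ =>
        carrierFace P K τ ≠ P ∧ v P ∉ carrierFace P K τ) =
        h.finite_faces.toFinset.filter fun τ => v P ∉ τ := by
      refine Finset.filter_congr fun τ hτ => ?_
      rw [Set.Finite.mem_toFinset] at hτ
      rw [h.apex_mem_iff hne hτ, and_iff_right_iff_imp]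
      intro hv heq
      exact hv ((h.apex_mem_iff hne hτ).1 (heq.symm ▸ hvP))
    rw [hf, add_assoc, ← Finset.sum_add_distrib]
    congr 1
    refine Finset.sum_congr rfl fun τ hτ => ?_
    rw [Finset.mem_filter, Set.Finite.mem_toFinset] at hτ
    obtain ⟨k, hk⟩ : ∃ k, τ.card = k + 1 :=
      Nat.exists_eq_succ_of_ne_zero (K.nonempty_of_mem_faces hτ.1).card_pos.ne'
    rw [hk, Nat.choose_succ_succ, Nat.add_sub_cancel]
    push_cast
    ring

/-- The interior polytope numbers count the interior simplices of the triangulation. -/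
theorem IsConeTriangulation.interiorNumber_eq (h : IsConeTriangulation P v K) (hne : P.Nonempty)
    (n : ℕ) : interiorNumber v P (n + 2) =
      ∑ᶠ τ ∈ interiorSimplices P K, (n.choose (τ.card - 1) : ℤ) := by
  classical
  induction hd : dim P using Nat.strong_induction_on generalizing P K n with
  | _ d ih =>
  have hI : ∀ (F : properFaces P) (n : ℕ), interiorNumber v F.1 (n + 2) =
      ∑ᶠ τ ∈ interiorSimplices F.1 (restrictComplex K F), (n.choose (τ.card - 1) : ℤ) :=
    fun F n => ih _ (hd ▸ dim_lt_of_mem_properFaces F.2) (h.restrict F.2.1) F.2.2.1 n rfl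
  rw [finsum_interiorSimplices_self h]
  by_cases h0 : dim P = 0
  -- For a point there are no proper faces and every simplex contains the apex, so only the leading
  -- `1` remains.
  · rw [interiorNumber, if_pos h0, if_neg (by omega), Finset.filter_true_of_mem,
      h.sum_choose hne, Finset.filter_false_of_mem]
    · simp
    · intro τ hτ
      rw [Set.Finite.mem_toFinset] at hτ
      have h1 := card_le_dim h.space_eq hτ
      have h2 := (K.nonempty_of_mem_faces hτ).card_pos
      exact not_not.2 (h.apex_mem_top hne hτ (by omega))
    · intro τ hτ
      rw [Set.Finite.mem_toFinset] at hτ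
      by_contra hcar
      have := dim_lt_of_mem_properFaces (carrierFace_mem_properFaces h hτ hcar)
      omega
  -- Now `P(n+2)` is the sum over all simplices; subtracting the terms with proper carriers leaves
  -- the interior ones.
  · rw [interiorNumber, if_neg h0, if_neg (by omega),
      h.numberRec_eq hne (fun F m => interiorNumber v F.1 m) hI (n + 1), ← h.sum_choose hne n]
    simp_rw [hI]
    have := finsum_properFaces h (fun τ => (n.choose (τ.card - 1) : ℤ)) (fun _ => True)
    simp only [if_true, and_true] at this
    rw [this, sub_eq_iff_eq_add, Finset.sum_filter_add_sum_filter_not]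

end Cone

end PolytopeNumbers

namespace PolytopeNumbers

/-! ### Binomial sums over intervals of faces -/

section Counting

theorem simplexNumber_natCast (d : ℕ) {m : ℕ} (hm : 1 ≤ m) :
    simplexNumber d m = ((m + d - 1).choose d : ℤ) := by
  rw [simplexNumber, if_neg (by omega), Int.toNat_natCast]

/-- Vandermonde's identity in the form needed for intervals of faces of a simplex. -/
theorem sum_choose_mul_choose (m r j : ℕ) :
    ∑ i ∈ Finset.range (r + 1), r.choose i * m.choose (j + i) = (m + r).choose (j + r) := by
  rw [Nat.add_choose_eq, Finset.Nat.sum_antidiagonal_eq_sum_range_succ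
    (fun a b => m.choose a * r.choose b), ← Finset.sum_range_reflect _ (j + r + 1)]
  rw [← Finset.sum_range_reflect]
  have hsub : Finset.range (r + 1) ⊆ Finset.range (j + r + 1) :=
    Finset.range_subset_range.2 (by omega)
  rw [← Finset.sum_subset hsub]
  · refine Finset.sum_congr rfl fun i hi => ?_
    rw [Finset.mem_range] at hi
    rw [mul_comm]
    congr 1
    · congr 1; omega
    · rw [show j + r - (j + r + 1 - 1 - i) = i by omega, show r + 1 - 1 - i = r - i by omega,
        Nat.choose_symm (by omega)]
  · intro i hi hi'
    rw [Finset.mem_range] at hi hi'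
    rw [Nat.choose_eq_zero_of_lt (show r < j + r - (j + r + 1 - 1 - i) by omega), mul_zero]

/-- The contribution of an interval of faces of a `d`-simplex is a simplex number. -/
theorem sum_Icc_choose {α : Type*} [DecidableEq α] {D σ : Finset α} (hD : D ⊆ σ)
    (hne : D.Nonempty) {d : ℕ} (hc : σ.card = d + 1) (n : ℕ) :
    ∑ τ ∈ Finset.Icc D σ, (n.choose (τ.card - 1) : ℤ) =
      simplexNumber d (((n + 2 : ℕ) : ℤ) - (D.card : ℤ)) := by
  obtain ⟨j, hj⟩ : ∃ j, D.card = j + 1 := Nat.exists_eq_succ_of_ne_zero hne.card_pos.ne'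
  have hle := Finset.card_le_card hD
  have hsd : (σ \ D).card = d - j := by rw [Finset.card_sdiff_of_subset hD]; omega
  have hinj : Set.InjOn (D ∪ ·) ((σ \ D).powerset : Set (Finset α)) := by
    intro a ha b hb hab
    have hda : Disjoint D a :=
      Finset.disjoint_sdiff.mono_right (Finset.mem_powerset.1 (Finset.mem_coe.1 ha))
    have hdb : Disjoint D b :=
      Finset.disjoint_sdiff.mono_right (Finset.mem_powerset.1 (Finset.mem_coe.1 hb))
    have := congrArg (· \ D) hab
    simpa [Finset.union_sdiff_cancel_left hda, Finset.union_sdiff_cancel_left hdb] using this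
  rw [Finset.Icc_eq_image_powerset hD, Finset.sum_image hinj]
  have h1 : ∑ a ∈ (σ \ D).powerset, (n.choose ((D ∪ a).card - 1) : ℤ) =
      ∑ a ∈ (σ \ D).powerset, (n.choose (j + a.card) : ℤ) := by
    refine Finset.sum_congr rfl fun a ha => ?_
    rw [Finset.card_union_of_disjoint
      (Finset.disjoint_sdiff.mono_right (Finset.mem_powerset.1 ha)), hj]
    congr 2
    omega
  rw [h1, Finset.sum_powerset_apply_card (fun i => (n.choose (j + i) : ℤ)), hsd]
  have h2 := sum_choose_mul_choose n (d - j) j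
  rw [show j + (d - j) = d by omega] at h2
  simp only [nsmul_eq_mul]
  have h3 : ∑ i ∈ Finset.range (d - j + 1), ((d - j).choose i : ℤ) * (n.choose (j + i) : ℤ) =
      ((n + (d - j)).choose d : ℤ) := by exact_mod_cast h2
  rw [h3]
  -- Since `|D| = j + 1`, the argument `n + 1 - j` is positive exactly in the first case; in the
  -- other, both sides vanish.
  by_cases hnj : j ≤ n
  · rw [show ((n + 2 : ℕ) : ℤ) - (D.card : ℤ) = ((n + 1 - j : ℕ) : ℤ) by omega,
      simplexNumber_natCast _ (by omega)]
    congr 2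
    omega
  · rw [simplexNumber, if_pos (by omega), Nat.choose_eq_zero_of_lt (by omega), Nat.cast_zero]

end Counting

/-! ### The polytope numbers of a simplex -/

section Simplex

variable {V : Type*} [NormedAddCommGroup V] [NormedSpace ℝ V]

/-- The complex of all the faces of a simplex. -/
def simplexComplex (T : Finset V) (hT : AffineIndependent ℝ ((↑) : T → V)) :
    Geometry.SimplicialComplex ℝ V where
  faces := {σ | σ ⊆ T ∧ σ.Nonempty}
  indep hσ := hT.mono (t := (T : Set V)) (by exact_mod_cast hσ.1)
  isRelLowerSet_faces := fun _ hσ => ⟨hσ.2, fun _ hτσ hτ => ⟨hτσ.trans hσ.1, hτ⟩⟩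
  inter_subset_convexHull hσ hτ := by
    classical
    rw [hT.convexHull_inter hσ.1 hτ.1]

theorem isConeTriangulation_simplexComplex [FiniteDimensional ℝ V] {T : Finset V}
    (hT : AffineIndependent ℝ ((↑) : T → V)) (hne : T.Nonempty) {w : Set V → V}
    (hw : IsApexChoice (convexHull ℝ (T : Set V)) w) :
    IsConeTriangulation (convexHull ℝ (T : Set V)) w (simplexComplex T hT) where
  finite_faces := T.powerset.finite_toSet.subset fun σ hσ => by simpa using hσ.1
  space_eq := by
    apply Set.Subset.antisymm
    · exact Set.iUnion₂_subset fun σ hσ => convexHull_mono (by exact_mod_cast hσ.1)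
    · exact (simplexComplex T hT).convexHull_subset_space ⟨subset_rfl, hne⟩
  convex := convex_convexHull ℝ _
  apex_vertex := hw
  apex_mem F hF hFne σ hσ hc := by
    classical
    have hFc := isFace_convex (convex_convexHull ℝ _) hF
    have hwF : w F ∈ F := (hw F hF hFne).1
    obtain ⟨τ, hτ, l, hl, hpos⟩ := exists_carrier (K := simplexComplex T hT) (p := w F)
      ((simplexComplex T hT).convexHull_subset_space ⟨subset_rfl, hne⟩ (hF.subset hwF))
    have hτF : (τ : Set V) ⊆ F := subset_face_of_isBary_pos hF
      (((Finset.coe_subset.2 hτ.1)).trans (subset_convexHull ℝ _)) hl hpos hwF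
    have hσF : (σ : Set V) ⊆ F := (subset_convexHull ℝ _).trans hσ.2
    have hun : ((σ ∪ τ : Finset V) : Set V) ⊆ F := by
      rw [Finset.coe_union]; exact Set.union_subset hσF hτF
    have hmem : σ ∪ τ ∈ (simplexComplex T hT).faces :=
      ⟨Finset.union_subset hσ.1.1 hτ.1, hσ.1.2.mono Finset.subset_union_left⟩
    have h1 := dim_of_affineIndependent ((simplexComplex T hT).indep hmem) hmem.2
    have h2 := dim_le_of_subset hun
    -- The simplex `σ ∪ τ` lies in `F`, so it has at most `dim F + 1` vertices, which `σ` already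
    -- has. Thus `σ` contains the simplex carrying the apex.
    have heq : σ = σ ∪ τ := Finset.eq_of_subset_of_card_le Finset.subset_union_left (by omega)
    have hτσ : τ ⊆ σ := by rw [heq]; exact Finset.subset_union_right
    exact convexHull_mono (Finset.coe_subset.2 hτσ)
      (hl.mem_convexHull fun y hy => (hpos y hy).le)

/-- The polytope numbers of a simplex do not depend on the apexes. -/
theorem polytopeNumber_simplex [FiniteDimensional ℝ V] {T : Finset V}
    (hT : AffineIndependent ℝ ((↑) : T → V)) {d : ℕ} (hc : T.card = d + 1) {w : Set V → V}
    (hw : IsApexChoice (convexHull ℝ (T : Set V)) w) (m : ℕ) :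
    polytopeNumber w (convexHull ℝ (T : Set V)) m = simplexNumber d m := by
  classical
  have hne : T.Nonempty := Finset.card_pos.1 (by omega)
  have hdim : dim (convexHull ℝ (T : Set V)) = d := by
    have := dim_of_affineIndependent hT hne
    rw [dim_convexHull]
    omega
  rw [polytopeNumber, hdim]
  rcases m with _ | m
  · simp [simplexNumber, numberRec]
  rw [simplexNumber_natCast d (by omega)]
  rcases Nat.eq_zero_or_pos d with rfl | h0
  · simp
  rw [if_neg h0.ne']
  have h := isConeTriangulation_simplexComplex hT hne hw
  have hPne : (convexHull ℝ (T : Set V)).Nonempty :=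
    convexHull_nonempty_iff.2 (Finset.coe_nonempty.2 hne)
  rw [h.numberRec_eq hPne _ fun F n =>
    (h.restrict F.2.1).interiorNumber_eq F.2.2.1 n]
  set u := w (convexHull ℝ (T : Set V))
  have huT : u ∈ T := extremePoints_convexHull_subset (hw _ (IsExposed.refl _) hPne)
  have hset : insert ∅ (h.finite_faces.toFinset.filter fun τ => u ∉ τ) =
      (T.erase u).powerset := by
    ext τ
    rw [Finset.mem_insert, Finset.mem_filter, Set.Finite.mem_toFinset, Finset.mem_powerset,
      Finset.subset_erase]
    change τ = ∅ ∨ (τ ⊆ T ∧ τ.Nonempty) ∧ u ∉ τ ↔ _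
    rcases τ.eq_empty_or_nonempty with rfl | hτ
    · simp
    · simp [hτ, hτ.ne_empty]
  have hsum := Finset.sum_powerset_apply_card (fun i => (m.choose i : ℤ)) (x := T.erase u)
  rw [← hset, Finset.sum_insert, Finset.card_erase_of_mem huT, hc] at hsum
  · rw [Finset.card_empty, Nat.choose_zero_right, Nat.cast_one] at hsum
    rw [hsum]
    have := sum_choose_mul_choose m d 0
    simp only [zero_add] at this
    simp only [nsmul_eq_mul, Nat.add_sub_cancel]
    rw [show m + 1 + d - 1 = m + d by omega]
    exact_mod_cast this
  · rw [Finset.mem_filter, Set.Finite.mem_toFinset]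
    exact fun h => (simplexComplex T hT).empty_notMem h.1

end Simplex

/-! ### The formula in terms of the `k`-vector -/

section Main

variable {V : Type*} [NormedAddCommGroup V] [NormedSpace ℝ V]

theorem sum_kVector_mul {P : Set V} {K : Geometry.SimplicialComplex ℝ V}
    (hT : (topSimplices P K).Finite) (x : V) (f : ℕ → ℤ) :
    ∑ j ∈ Finset.range (dim P + 2), (kVector P K x j : ℤ) * f j =
      ∑ σ ∈ hT.toFinset, f (oppNotVisible x σ).card := by
  classical
  rw [← Finset.sum_fiberwise_of_maps_to (g := fun σ => (oppNotVisible x σ).card)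
    (t := Finset.range (dim P + 2))]
  · refine Finset.sum_congr rfl fun j _ => ?_
    rw [Finset.sum_congr rfl fun σ hσ => congrArg f (Finset.mem_filter.1 hσ).2, Finset.sum_const,
      nsmul_eq_mul, kVector, ← Set.ncard_coe_finset]
    congr 3
    ext σ
    simp
  · intro σ hσ
    rw [Set.Finite.mem_toFinset] at hσ
    have := Finset.card_le_card (oppNotVisible_subset x σ)
    rw [Finset.mem_range]
    have := hσ.2
    omega

theorem interiorNumber_eq_sum_kVector [FiniteDimensional ℝ V] {P : Set V} {v : Set V → V}
    {K : Geometry.SimplicialComplex ℝ V} (h : IsConeTriangulation P v K) (hne : P.Nonempty) {x : V}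
    (hx : IsGeneric P K x) {n : ℕ} (hn : 1 ≤ dim P ∨ n ≠ 1) :
    interiorNumber v P n =
      ∑ j ∈ Finset.range (dim P + 2),
        (kVector P K x j : ℤ) * simplexNumber (dim P) ((n : ℤ) - (j : ℤ)) := by
  classical
  have hT : (topSimplices P K).Finite := h.finite_faces.subset fun _ hσ => hσ.1
  have hDne : ∀ σ ∈ topSimplices P K, (oppNotVisible x σ).Nonempty := fun σ hσ =>
    oppNotVisible_nonempty h.space_eq hx hσ.1 hσ.2
  rw [sum_kVector_mul hT x (fun j => simplexNumber (dim P) ((n : ℤ) - (j : ℤ)))]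
  rcases lt_or_ge n 2 with hn2 | hn2
  -- For `n ≤ 1` every argument `n - |D_σ|` is at most `0`, because `D_σ` is nonempty; a point with
  -- `n = 1`, whose interior number is `1`, is excluded by `hn`.
  · rw [Finset.sum_eq_zero]
    · rw [interiorNumber]
      split_ifs <;> first | rfl | omega
    · intro σ hσ
      have := (hDne σ ((Set.Finite.mem_toFinset _).1 hσ)).card_pos
      rw [simplexNumber, if_pos (by omega)]
  · obtain ⟨m, rfl⟩ := Nat.exists_eq_add_of_le' hn2
    rw [h.interiorNumber_eq hne, interiorSimplices_eq_iUnion h.finite_faces h.space_eq h.convex hx,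
      finsum_mem_biUnion (pairwiseDisjoint_Icc_oppNotVisible h.space_eq hx) hT
        (fun σ _ => Set.finite_Icc _ _), finsum_mem_eq_finite_toFinset_sum _ hT]
    refine Finset.sum_congr rfl fun σ hσ => ?_
    rw [Set.Finite.mem_toFinset] at hσ
    rw [← sum_Icc_choose (oppNotVisible_subset x σ) (hDne σ hσ) hσ.2, ← Finset.coe_Icc,
      finsum_mem_coe_finset]

end Main

end PolytopeNumbers

theorem mainTheorem3 (N : ℕ) (P : Set (EuclideanSpace ℝ (Fin N)))
    (hP : PolytopeNumbers.IsPolytope P) (hne : P.Nonempty)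
    (v : Set (EuclideanSpace ℝ (Fin N)) → EuclideanSpace ℝ (Fin N))
    (K : Geometry.SimplicialComplex ℝ (EuclideanSpace ℝ (Fin N)))
    (hK : PolytopeNumbers.IsPointedTriangulation P v K)
    (x : EuclideanSpace ℝ (Fin N)) (hx : PolytopeNumbers.IsGeneric P K x) :
    -- the interior simplices are the disjoint union of the intervals `[D_F, F]`
    (PolytopeNumbers.interiorSimplices P K =
        ⋃ σ ∈ PolytopeNumbers.topSimplices P K,
          Set.Icc (PolytopeNumbers.oppNotVisible x σ) σ) ∧
    (PolytopeNumbers.topSimplices P K).PairwiseDisjoint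
        (fun σ => Set.Icc (PolytopeNumbers.oppNotVisible x σ) σ) ∧
    -- the formula for the interior polytope numbers
    (∀ n : ℕ, (1 ≤ PolytopeNumbers.dim P ∨ n ≠ 1) →
      PolytopeNumbers.interiorNumber v P n =
        ∑ j ∈ Finset.range (PolytopeNumbers.dim P + 2),
          (PolytopeNumbers.kVector P K x j : ℤ) *
            PolytopeNumbers.simplexNumber (PolytopeNumbers.dim P) ((n : ℤ) - (j : ℤ))) ∧
    -- the numbers `α^d` in it are the polytope numbers of every `d`-simplex, for any apexes
    (∀ T : Finset (EuclideanSpace ℝ (Fin N)),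
      AffineIndependent ℝ ((↑) : T → EuclideanSpace ℝ (Fin N)) →
      T.card = PolytopeNumbers.dim P + 1 →
      ∀ w : Set (EuclideanSpace ℝ (Fin N)) → EuclideanSpace ℝ (Fin N),
        PolytopeNumbers.IsApexChoice (convexHull ℝ (T : Set (EuclideanSpace ℝ (Fin N)))) w →
        ∀ m : ℕ, PolytopeNumbers.polytopeNumber w
            (convexHull ℝ (T : Set (EuclideanSpace ℝ (Fin N)))) m =
          PolytopeNumbers.simplexNumber (PolytopeNumbers.dim P) (m : ℤ)) := by
  have hPc : Convex ℝ P := by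
    obtain ⟨s, -, rfl⟩ := hP
    exact convex_convexHull ℝ s
  have h : PolytopeNumbers.IsConeTriangulation P v K :=
    ⟨hK.finite_faces, hK.space_eq, hPc, hK.apex_vertex, hK.apex_mem⟩
  exact ⟨PolytopeNumbers.interiorSimplices_eq_iUnion h.finite_faces h.space_eq hPc hx,
    PolytopeNumbers.pairwiseDisjoint_Icc_oppNotVisible h.space_eq hx,
    fun _ hn => PolytopeNumbers.interiorNumber_eq_sum_kVector h hne hx hn,
    fun _ hT hc _ hw m => PolytopeNumbers.polytopeNumber_simplex hT hc hw m⟩
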